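/- Let $k$ be a field of characteristic $0$ (for instance $k=\mathbb R$), $N\ge 1$, and $\beta,\omega\in k$ with $\omega\neq 0$. Let $P=k[x_1,\dots,x_N]\otimes_k\Lambda_k(\theta_1,\dots,\theta_N)$ be the space of superpolynomials in the commuting variables $x_i$ and the anticommuting variables $\theta_i$. Let $K_{ij}$ exchange $x_i$ and $x_j$ (leaving the $\theta$'s fixed), for $w\in S_N$ let $\mathcal K_w$ be the simultaneous permutation $x_i\mapsto x_{w(i)}$, $\theta_i\mapsto\theta_{w(i)}$, and let $P^{S_N}=\{f\in P:\mathcal K_{(ij)}f=f\text{ for all }i,j\}$ be the space of symmetric superpolynomials. Write $x_{jk}=x_j-x_k$, $\partial_j=\partial/\partial x_j$, let $\partial_{\theta_1}$ be the left derivative with respect to $\theta_1$, and define operators on $P$ by $$D_j=\partial_j+\beta\sum_{k\ne j}\frac1{x_{jk}}(1-K_{jk}),\qquad D_j^\dagger=2\omega x_j-D_j,\qquad \Delta=\sum_{j=1}^N D_j^2,$$ $$\mathcal D_j=x_j\partial_j+\beta\sum_{k<j}\frac{x_j}{x_{jk}}(1-K_{jk})+\beta\sum_{k>j}\frac{x_k}{x_{jk}}(1-K_{jk})-\beta(j-1),$$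 $$\mathcal D_j^\omega=\frac1{2\omega}D_j^\dagger D_j+\beta\sum_{k>j}K_{jk}-\beta(N-1),$$ and, for $n=1,\dots,N$, $$\mathcal H_n=\sum_{j=1}^N\mathcal D_j^{\,n},\quad \mathcal I_{n-1}=\sum_{w\in S_N}\mathcal K_w\,\theta_1\partial_{\theta_1}\mathcal D_1^{\,n-1},\qquad \mathcal H_n^\omega=\sum_{j=1}^N(\mathcal D_j^\omega)^n,\quad \mathcal I_{n-1}^\omega=\sum_{w\in S_N}\mathcal K_w\,\theta_1\partial_{\theta_1}(\mathcal D_1^\omega)^{n-1}.$$ The operator $\Delta$ is locally nilpotent on $P$, so that $e^{c\Delta}=\sum_{r\ge0}c^r\Delta^r/r!$ is a well-defined operator on $P$ for every $c\in k$. Then, for all $m,n\in\{1,\dots,N\}$: 1. on $P$, $$\mathcal H_n^\omega=e^{-\frac1{4\omega}\Delta}\,\mathcal H_n\,e^{\frac1{4\omega}\Delta},\qquad \mathcal I_{n-1}^\omega=e^{-\frac1{4\omega}\Delta}\,\mathcal I_{n-1}\,e^{\frac1{4\omega}\Delta};$$ 2. $\mathcal H_n^\omega$ and $\mathcal I_{n-1}^\omega$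 map $P^{S_N}$ into itself, and their restrictions satisfy $$[\mathcal H_m^\omega|_{P^{S_N}},\mathcal H_n^\omega|_{P^{S_N}}]=[\mathcal H_m^\omega|_{P^{S_N}},\mathcal I_{n-1}^\omega|_{P^{S_N}}]=[\mathcal I_{m-1}^\omega|_{P^{S_N}},\mathcal I_{n-1}^\omega|_{P^{S_N}}]=0.$$ -/

import Mathlib

namespace SrCMS

open MvPolynomial
open scoped TensorProduct

noncomputable section

/-! ## Superpolynomials -/

/-- The ring of polynomials in the commuting variables `x_1, …, x_N`. -/
abbrev BosPoly (k : Type*) [Field k] (N : ℕ) : Type _ := MvPolynomial (Fin N) k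

/-- The Grassmann algebra generated by the anticommuting variables `θ_1, …, θ_N`. -/
abbrev Grass (k : Type*) [Field k] (N : ℕ) : Type _ := ExteriorAlgebra k (Fin N →₀ k)

/-- Superpolynomials: polynomials in the `x_i` and `θ_i`. -/
abbrev SuperPoly (k : Type*) [Field k] (N : ℕ) : Type _ := BosPoly k N ⊗[k] Grass k N

variable {k : Type*} [Field k] {N : ℕ}

/-- A shortcut for instance search. -/
instance : AddCommGroup (SuperPoly k N) := TensorProduct.addCommGroup

/-- An operator on polynomials in `x`, acting on superpolynomials (the `θ_i` being constants). -/
def liftX (T : Module.End k (BosPoly k N)) : Module.End k (SuperPoly k N) :=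
  LinearMap.rTensor (Grass k N) T

/-- An operator on the Grassmann algebra, acting on superpolynomials (the `x_i` being constants). -/
def liftTheta (S : Module.End k (Grass k N)) : Module.End k (SuperPoly k N) :=
  LinearMap.lTensor (BosPoly k N) S

/-! ## Elementary operators -/

/-- Multiplication by `x_j`. -/
def xMul (j : Fin N) : Module.End k (BosPoly k N) :=
  LinearMap.mulLeft k (X j : BosPoly k N)

/-- The partial derivative with respect to `x_j`. -/
def dX (j : Fin N) : Module.End k (BosPoly k N) := (pderiv j).toLinearMap

/-- `K_w`: the permutation of the bosonic variables `x_i ↦ x_{w(i)}`. -/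
def permX (w : Equiv.Perm (Fin N)) : Module.End k (BosPoly k N) :=
  (rename w : BosPoly k N →ₐ[k] BosPoly k N).toLinearMap

/-- `κ_w`: the permutation of the fermionic variables `θ_i ↦ θ_{w(i)}`. -/
def permTheta (w : Equiv.Perm (Fin N)) : Module.End k (Grass k N) :=
  (ExteriorAlgebra.map (Finsupp.lmapDomain k k w)).toLinearMap

/-- Left multiplication by `θ_j`. -/
def thetaMul (j : Fin N) : Module.End k (Grass k N) :=
  LinearMap.mulLeft k (ExteriorAlgebra.ι k (Finsupp.single j (1 : k)))

/-- The (left) derivative with respect to `θ_j`: the antiderivation with `θ_i ↦ δ_{ij}`. -/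
def dTheta (j : Fin N) : Module.End k (Grass k N) :=
  CliffordAlgebra.contractLeft (Q := (0 : QuadraticForm k (Fin N →₀ k))) (Finsupp.lapply j)

/-- `𝒦_w = κ_w K_w`: simultaneous permutation of the `x_i` and of the `θ_i`. -/
def superPerm (w : Equiv.Perm (Fin N)) : Module.End k (SuperPoly k N) :=
  liftTheta (permTheta w) * liftX (permX w)

variable (k N) in
/-- `P^{S_N}`: the space of symmetric superpolynomials, those with `𝒦_{ij} f = f` for all
`i, j`. -/
def symSuperPoly : Submodule k (SuperPoly k N) where
  carrier := {f | ∀ i j : Fin N, superPerm (Equiv.swap i j) f = f}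
  zero_mem' := by intro i j; simp
  add_mem' := by intro a b ha hb i j; rw [map_add, ha, hb]
  smul_mem' := by intro c a ha i j; rw [map_smul, ha]

/-- The restriction `T|_{P^{S_N}}` of an operator that preserves `P^{S_N}`. -/
def restrictSym (T : Module.End k (SuperPoly k N))
    (hT : ∀ f ∈ symSuperPoly k N, T f ∈ symSuperPoly k N) :
    Module.End k (symSuperPoly k N) :=
  T.restrict hT

/-! ## Divided differences -/

theorem sub_dvd_sub_permX (i j : Fin N) (f : BosPoly k N) :
    (X i - X j : BosPoly k N) ∣ f - permX (Equiv.swap i j) f := by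
  induction f using MvPolynomial.induction_on with
  | C a => simp [permX]
  | add p q hp hq =>
    have := dvd_add hp hq
    rw [map_add]
    convert this using 1
    ring
  | mul_X p l hp =>
    have h1 : permX (Equiv.swap i j) (p * X l) =
        permX (Equiv.swap i j) p * (X (Equiv.swap i j l) : BosPoly k N) := by
      simp [permX]
    have h2 : (X i - X j : BosPoly k N) ∣ X l - X (Equiv.swap i j l) := by
      rw [Equiv.swap_apply_def]
      split_ifs with ha hb
      · rw [ha]
      · rw [hb]; exact ⟨-1, by ring⟩
      · simp
    rw [h1]
    have h3 := dvd_add (Dvd.dvd.mul_right hp (X l))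
      (Dvd.dvd.mul_left h2 (permX (Equiv.swap i j) p))
    convert h3 using 1
    ring

theorem X_sub_X_ne_zero {i j : Fin N} (h : i ≠ j) : (X i - X j : BosPoly k N) ≠ 0 := by
  rw [sub_ne_zero]
  exact fun e => h (X_injective e)

/-- The divided difference `f ↦ (1 - K_{ij}) f / (x_i - x_j)` for `i ≠ j` (and `0` for `i = j`);
see `X_sub_X_mul_divDiff`. -/
def divDiff (i j : Fin N) : Module.End k (BosPoly k N) :=
  if h : i = j then 0 else
  { toFun := fun f => (sub_dvd_sub_permX i j f).choose
    map_add' := fun f g => by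
      apply mul_left_cancel₀ (X_sub_X_ne_zero (k := k) h)
      rw [mul_add, ← (sub_dvd_sub_permX i j (f + g)).choose_spec,
        ← (sub_dvd_sub_permX i j f).choose_spec, ← (sub_dvd_sub_permX i j g).choose_spec,
        map_add]
      ring
    map_smul' := fun c f => by
      apply mul_left_cancel₀ (X_sub_X_ne_zero (k := k) h)
      rw [RingHom.id_apply, mul_smul_comm, ← (sub_dvd_sub_permX i j (c • f)).choose_spec,
        ← (sub_dvd_sub_permX i j f).choose_spec, map_smul, smul_sub] }

theorem X_sub_X_mul_divDiff {i j : Fin N} (h : i ≠ j) (f : BosPoly k N) :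
    (X i - X j) * divDiff i j f = f - permX (Equiv.swap i j) f := by
  rw [divDiff, dif_neg h]
  exact (sub_dvd_sub_permX i j f).choose_spec.symm

/-! ## Dunkl operators -/

/-- The rational Dunkl operator
`D_j = ∂_j + β ∑_{l ≠ j} (x_j - x_l)⁻¹ (1 - K_{jl})`. -/
def dunkl (β : k) (j : Fin N) : Module.End k (BosPoly k N) :=
  dX j + β • ∑ l ∈ Finset.univ.erase j, divDiff j l

/-- `D_j† = 2 ω x_j - D_j`. -/
def dunklAdj (β ω : k) (j : Fin N) : Module.End k (BosPoly k N) :=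
  (2 * ω) • xMul j - dunkl β j

/-- The operator
`𝒟_j^ω = (2ω)⁻¹ D_j† D_j + β ∑_{l > j} K_{jl} - β (N - 1)`. -/
def dunklOmega (β ω : k) (j : Fin N) : Module.End k (BosPoly k N) :=
  (2 * ω)⁻¹ • (dunklAdj β ω j * dunkl β j)
    + β • ∑ l ∈ Finset.univ.filter (fun l => j < l), permX (Equiv.swap j l)
    - (β * ((N : k) - 1)) • (1 : Module.End k (BosPoly k N))

/-- The trigonometric Dunkl (Cherednik) operator
`𝒟_j = x_j ∂_j + β ∑_{l < j} x_j (x_j - x_l)⁻¹ (1 - K_{jl})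
  + β ∑_{l > j} x_l (x_j - x_l)⁻¹ (1 - K_{jl}) - β (j - 1)`.
The indices of `Fin N` start at `0`, so that `j - 1` becomes `(j : ℕ)`. -/
def dunklTrig (β : k) (j : Fin N) : Module.End k (BosPoly k N) :=
  xMul j * dX j
    + β • ∑ l ∈ Finset.univ.filter (fun l => l < j), xMul j * divDiff j l
    + β • ∑ l ∈ Finset.univ.filter (fun l => j < l), xMul l * divDiff j l
    - (β * ((j : ℕ) : k)) • (1 : Module.End k (BosPoly k N))

/-! ## Conserved operators -/

/-- The trigonometric charge `ℋ_n = ∑_j 𝒟_j ^ n`. -/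
def trigH (β : k) (n : ℕ) : Module.End k (SuperPoly k N) :=
  ∑ j : Fin N, liftX (dunklTrig β j) ^ n

/-- The trigonometric charge `ℐ_r = ∑_{w ∈ S_N} 𝒦_w θ_1 ∂_{θ_1} 𝒟_1 ^ r`. -/
def trigI [NeZero N] (β : k) (r : ℕ) : Module.End k (SuperPoly k N) :=
  ∑ w : Equiv.Perm (Fin N),
    superPerm w * liftTheta (thetaMul 0) * liftTheta (dTheta 0) * liftX (dunklTrig β 0) ^ r

/-- The rational charge `ℋ_n^ω = ∑_j (𝒟_j^ω) ^ n`. -/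
def ratH (β ω : k) (n : ℕ) : Module.End k (SuperPoly k N) :=
  ∑ j : Fin N, liftX (dunklOmega β ω j) ^ n

/-- The rational charge `ℐ_r^ω = ∑_{w ∈ S_N} 𝒦_w θ_1 ∂_{θ_1} (𝒟_1^ω) ^ r`. -/
def ratI [NeZero N] (β ω : k) (r : ℕ) : Module.End k (SuperPoly k N) :=
  ∑ w : Equiv.Perm (Fin N),
    superPerm w * liftTheta (thetaMul 0) * liftTheta (dTheta 0) * liftX (dunklOmega β ω 0) ^ r

/-! ## The operator `Δ` and its exponentials -/

/-- `Δ_β = ∑_j D_j ^ 2` on polynomials in `x`. -/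
def deltaX (β : k) : Module.End k (BosPoly k N) := ∑ j : Fin N, dunkl β j ^ 2

/-- `Δ = ∑_j D_j ^ 2` on superpolynomials. -/
def delta (β : k) : Module.End k (SuperPoly k N) := ∑ j : Fin N, liftX (dunkl β j) ^ 2

/-- The exponential `∑_r T ^ r / r!` of a locally nilpotent operator: on each vector the sum is
finite. -/
def locExp {V : Type*} [AddCommGroup V] [Module k V] (T : Module.End k V)
    (hT : ∀ v, ∃ r : ℕ, (T ^ r) v = 0) : Module.End k V :=
  have hfin : ∀ v, (Function.support
      (fun r : ℕ => ((r.factorial : k)⁻¹) • (T ^ r) v)).Finite := fun v => by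
    obtain ⟨s, hs⟩ := hT v
    refine (Set.finite_lt_nat s).subset fun r hr => ?_
    by_contra hlt
    apply hr
    have hle : s ≤ r := not_lt.1 hlt
    have : (T ^ r) v = 0 := by
      rw [← Nat.sub_add_cancel hle, pow_add, Module.End.mul_apply, hs, map_zero]
    simp [this]
  { toFun := fun v => ∑ᶠ r : ℕ, ((r.factorial : k)⁻¹) • (T ^ r) v
    map_add' := fun u v => by
      rw [← finsum_add_distrib (hfin u) (hfin v)]
      exact finsum_congr fun r => by rw [map_add, smul_add]
    map_smul' := fun c v => by
      rw [RingHom.id_apply, smul_finsum' c (hfin v)]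
      exact finsum_congr fun r => by rw [map_smul, smul_comm] }

theorem dunkl_totalDegree (β : k) (j : Fin N) (f : BosPoly k N) (d : ℕ)
    (hf : f.totalDegree ≤ d) : dunkl β j f = 0 ∨ (dunkl β j f).totalDegree + 1 ≤ d := by
  have key : ∀ i l : Fin N, divDiff i l f = 0 ∨ (divDiff i l f).totalDegree + 1 ≤ d := by
    intro i l
    by_cases h : i = l
    · left; simp [divDiff, h]
    · by_cases h0 : divDiff i l f = 0
      · exact Or.inl h0
      · right
        have h1 := X_sub_X_mul_divDiff h f
        have h2 : ((X i - X l : BosPoly k N) * divDiff i l f).totalDegree ≤ d := by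
          rw [h1]
          refine (totalDegree_sub _ _).trans (max_le hf ?_)
          exact (totalDegree_rename_le _ f).trans hf
        rw [totalDegree_mul_of_isDomain (X_sub_X_ne_zero h) h0] at h2
        have h3 : (X i - X l : BosPoly k N).totalDegree ≠ 0 := by
          intro h4
          rw [totalDegree_eq_zero_iff_eq_C] at h4
          have h5 : coeff (Finsupp.single i 1) (X i - X l : BosPoly k N) = 1 := by
            have h6 : Finsupp.single l 1 ≠ (Finsupp.single i 1 : Fin N →₀ ℕ) := fun h7 =>
              h ((Finsupp.single_left_injective one_ne_zero h7).symm)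
            rw [coeff_sub, coeff_X, coeff_X, if_pos rfl, if_neg h6, sub_zero]
          rw [h4, coeff_C, if_neg] at h5
          · exact zero_ne_one h5
          · exact fun h6 => by simpa using (Finsupp.single_eq_zero.1 h6.symm)
        omega
  rcases d with _ | d
  · left
    have hz : ∀ i l : Fin N, divDiff i l f = 0 := fun i l => by
      rcases key i l with h | h
      · exact h
      · omega
    have hd : dX j f = 0 := by
      have := (totalDegree_eq_zero_iff_eq_C (p := f)).1 (Nat.le_zero.1 hf)
      rw [this]; simp [dX]
    simp [dunkl, hd, hz]
  · right
    have hd : (dX j f).totalDegree ≤ d := by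
      have : (pderiv j f).totalDegree ≤ f.totalDegree - 1 := by
        rw [totalDegree]
        refine Finset.sup_le fun m hm => ?_
        rw [mem_support_iff, coeff_pderiv] at hm
        have h1 : m + Finsupp.single j 1 ∈ f.support := by
          rw [mem_support_iff]
          exact fun h => hm (by rw [h, zero_mul])
        have h2 := le_totalDegree h1
        rw [Finsupp.sum_add_index' (by simp) (by simp), Finsupp.sum_single_index rfl] at h2
        omega
      exact this.trans (by omega)
    have hs : (β • ∑ l ∈ Finset.univ.erase j, divDiff j l f).totalDegree ≤ d := by
      refine (totalDegree_smul_le _ _).trans (totalDegree_finsetSum_le fun l _ => ?_)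
      rcases key j l with h | h
      · simp [h]
      · omega
    have : dunkl β j f = dX j f + β • ∑ l ∈ Finset.univ.erase j, divDiff j l f := by
      simp [dunkl]
    rw [this]
    have := (totalDegree_add (dX j f) (β • ∑ l ∈ Finset.univ.erase j, divDiff j l f))
    have := max_le hd hs
    omega

theorem deltaX_locNilp (β : k) (f : BosPoly k N) : ∃ r : ℕ, (deltaX β ^ r) f = 0 := by
  suffices h : ∀ (d : ℕ) (f : BosPoly k N), f.totalDegree ≤ d → (deltaX β ^ (d + 1)) f = 0 from
    ⟨_, h _ f le_rfl⟩
  intro d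
  induction d using Nat.strong_induction_on with
  | _ d ih =>
    intro f hf
    rw [pow_succ, Module.End.mul_apply, deltaX, LinearMap.sum_apply, map_sum]
    refine Finset.sum_eq_zero fun j _ => ?_
    rw [pow_two, Module.End.mul_apply]
    rcases dunkl_totalDegree β j f d hf with h | h
    · rw [h, map_zero, map_zero]
    · rcases dunkl_totalDegree β j (dunkl β j f) (d - 1) (by omega) with h' | h'
      · rw [h', map_zero]
      · have h2 := ih (d - 1) (by omega) (dunkl β j (dunkl β j f)) (by omega)
        rw [show d - 1 + 1 = d by omega] at h2
        exact h2

theorem delta_eq_liftX (β : k) : (delta β : Module.End k (SuperPoly k N)) = liftX (deltaX β) := by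
  rw [delta, deltaX, liftX, LinearMap.rTensor, ← LinearMap.rTensor_def]
  rw [show LinearMap.rTensor (Grass k N) (∑ j : Fin N, dunkl β j ^ 2)
      = ∑ j : Fin N, LinearMap.rTensor (Grass k N) (dunkl β j ^ 2) from
    map_sum (LinearMap.rTensorHom (Grass k N)) _ _]
  refine Finset.sum_congr rfl fun j _ => ?_
  rw [liftX, LinearMap.rTensor_pow]

theorem smul_delta_locNilp (β c : k) (f : SuperPoly k N) :
    ∃ r : ℕ, ((c • delta β : Module.End k (SuperPoly k N)) ^ r) f = 0 := by
  suffices h : ∃ r : ℕ, ((delta β : Module.End k (SuperPoly k N)) ^ r) f = 0 by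
    obtain ⟨r, hr⟩ := h
    exact ⟨r, by rw [smul_pow, LinearMap.smul_apply, hr, smul_zero]⟩
  rw [delta_eq_liftX]
  have hmono : ∀ (T : Module.End k (SuperPoly k N)) (g : SuperPoly k N) (r s : ℕ), r ≤ s →
      (T ^ r) g = 0 → (T ^ s) g = 0 := fun T g r s hrs h => by
    rw [← Nat.sub_add_cancel hrs, pow_add, Module.End.mul_apply, h, map_zero]
  induction f using TensorProduct.induction_on with
  | zero => exact ⟨0, by simp⟩
  | tmul p v =>
    obtain ⟨r, hr⟩ := deltaX_locNilp β p
    refine ⟨r, ?_⟩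
    rw [liftX, LinearMap.rTensor_pow, LinearMap.rTensor_tmul, hr, TensorProduct.zero_tmul]
  | add f g hf hg =>
    obtain ⟨r, hr⟩ := hf
    obtain ⟨s, hs⟩ := hg
    refine ⟨max r s, ?_⟩
    rw [map_add, hmono _ _ _ _ (le_max_left r s) hr, hmono _ _ _ _ (le_max_right r s) hs,
      add_zero]

/-- The operator `e^{c Δ}` on superpolynomials. -/
def expDelta (β c : k) : Module.End k (SuperPoly k N) :=
  locExp (c • delta β) (smul_delta_locNilp β c)

end

end SrCMS

namespace SrCMS

open MvPolynomial
open scoped TensorProduct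

noncomputable section

variable {k : Type*} [Field k] {N : ℕ}

/-! ## Relations between the `x_j`, the Dunkl operators and the permutations -/

/-! The multiplications `x_j`, the Dunkl operators `D_j` and the permutations `K_w` satisfy the
relations of the rational Cherednik algebra (`DunklRel`), and these relations survive the shift `x_j
↦ x_j - γ D_j` (`DunklRel.sub_smul`). One formula, `cherednik`, gives the trigonometric `𝒟_j` from
`x_j` and, with `γ = 1/(2ω)`, the operators `𝒟_j^ω` from the shifted coordinates (`dunklTrig_eq`,
`dunklOmega_eq`). Commutativity of the rational charges is thus proved directly from the relations
and does not pass through the exponential.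

The similarity comes from `[Δ, x_j] = 2 D_j` together with the fact that `Δ` commutes with every
`D_j` and `K_w`: conjugation by `e^{cΔ}` then moves `x_j` to `x_j - 2c D_j` and fixes the rest
(`mul_locExp`), and `c = 1/(4ω)` gives the required shift.

For commutativity, `𝒟_j = E_j - β J_j`, where the Heckman operators `E_j` are permuted by `S_N` and
satisfy `[E_i, E_j] = β (E_i - E_j) K_{ij}`, and the `J_j` are Jucys-Murphy sums. Hence the `𝒟_j`
commute, and their power sums commute with `S_N` by the degenerate affine Hecke relation. This
settles every bracket containing some `ℋ`.

Two charges `ℐ` commute only on symmetric superpolynomials. There `𝒦_w` can be moved to the right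
and dropped, which leaves `∑_w θ_{w(1)} ∂_{θ_{w(1)}} E_{w(1)}^r`. The terms with indices `(i, j)`
and `(j, i)` of the commutator of two such sums cancel by `lie_pow_add_lie_pow`. -/

/-- `w ↦ K_w` as a monoid homomorphism. -/
def permXHom : Equiv.Perm (Fin N) →* Module.End k (BosPoly k N) where
  toFun := permX
  map_one' := by refine LinearMap.ext fun f => ?_; simp [permX]
  map_mul' v w := by refine LinearMap.ext fun f => ?_; simp [permX, rename_rename, Equiv.Perm.coe_mul]

theorem permXHom_apply (w : Equiv.Perm (Fin N)) :
    (permXHom w : Module.End k (BosPoly k N)) = permX w := rfl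

theorem permX_apply_mul (w : Equiv.Perm (Fin N)) (f g : BosPoly k N) :
    permX w (f * g) = permX w f * permX w g := by simp [permX]

theorem permX_X (w : Equiv.Perm (Fin N)) (j : Fin N) :
    permX w (X j : BosPoly k N) = X (w j) := by simp [permX]

theorem permX_mul_xMul (w : Equiv.Perm (Fin N)) (j : Fin N) :
    (permX w * xMul j : Module.End k (BosPoly k N)) = xMul (w j) * permX w := by
  refine LinearMap.ext fun f => ?_
  simp [xMul, permX]

theorem permX_mul_dX (w : Equiv.Perm (Fin N)) (j : Fin N) :
    (permX w * dX j : Module.End k (BosPoly k N)) = dX (w j) * permX w := by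
  refine LinearMap.ext fun f => ?_
  simp [dX, permX, pderiv_rename w.injective]

theorem permX_mul_permX_swap (w : Equiv.Perm (Fin N)) (i j : Fin N) :
    (permX w * permX (Equiv.swap i j) : Module.End k (BosPoly k N)) =
      permX (Equiv.swap (w i) (w j)) * permX w := by
  simp only [← permXHom_apply, ← map_mul]
  rw [Equiv.mul_swap_eq_swap_mul]

/-- Polynomials form a domain, so identities between divided differences can be checked after
multiplying by the nonzero difference of variables. The next few lemmas use the same device. -/
theorem permX_mul_divDiff (w : Equiv.Perm (Fin N)) (i j : Fin N) :
    (permX w * divDiff i j : Module.End k (BosPoly k N)) = divDiff (w i) (w j) * permX w := by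
  by_cases h : i = j
  · simp [h, divDiff]
  refine LinearMap.ext fun f => ?_
  have hw : w i ≠ w j := fun e => h (w.injective e)
  apply mul_left_cancel₀ (X_sub_X_ne_zero (k := k) hw)
  rw [Module.End.mul_apply, Module.End.mul_apply, X_sub_X_mul_divDiff hw, ← permX_X, ← permX_X,
    ← map_sub, ← permX_apply_mul, X_sub_X_mul_divDiff h, map_sub]
  exact congrArg _ (LinearMap.congr_fun (permX_mul_permX_swap w i j) f)

theorem permX_mul_dunkl (β : k) (w : Equiv.Perm (Fin N)) (j : Fin N) :
    permX w * dunkl β j = dunkl β (w j) * permX w := by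
  rw [dunkl, dunkl, mul_add, add_mul, permX_mul_dX, mul_smul_comm, smul_mul_assoc,
    Finset.mul_sum, Finset.sum_mul]
  congr 2
  refine Finset.sum_equiv w (by simp) fun l _ => permX_mul_divDiff w j l

theorem dX_mul_xMul (i j : Fin N) : (dX i * xMul j : Module.End k (BosPoly k N)) =
    xMul j * dX i + if i = j then 1 else 0 := by
  refine LinearMap.ext fun f => ?_
  split_ifs with h <;> simp [dX, xMul, pderiv_X, h, add_comm]

theorem divDiff_mul_xMul_left {i j : Fin N} (h : i ≠ j) :
    (divDiff i j * xMul i : Module.End k (BosPoly k N)) =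
      xMul i * divDiff i j + permX (Equiv.swap i j) := by
  refine LinearMap.ext fun f => ?_
  apply mul_left_cancel₀ (X_sub_X_ne_zero (k := k) h)
  simp only [Module.End.mul_apply, LinearMap.add_apply, X_sub_X_mul_divDiff h, xMul,
    LinearMap.mulLeft_apply, permX_apply_mul, permX_X, Equiv.swap_apply_left]
  linear_combination (-(X i : BosPoly k N)) * X_sub_X_mul_divDiff h f

theorem divDiff_mul_xMul_right {i j : Fin N} (h : i ≠ j) :
    (divDiff i j * xMul j : Module.End k (BosPoly k N)) =
      xMul j * divDiff i j - permX (Equiv.swap i j) := by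
  refine LinearMap.ext fun f => ?_
  apply mul_left_cancel₀ (X_sub_X_ne_zero (k := k) h)
  simp only [Module.End.mul_apply, LinearMap.sub_apply, X_sub_X_mul_divDiff h, xMul,
    LinearMap.mulLeft_apply, permX_apply_mul, permX_X, Equiv.swap_apply_right]
  linear_combination (-(X j : BosPoly k N)) * X_sub_X_mul_divDiff h f

theorem divDiff_mul_xMul_of_ne {i j l : Fin N} (hi : l ≠ i) (hj : l ≠ j) :
    (divDiff i j * xMul l : Module.End k (BosPoly k N)) = xMul l * divDiff i j := by
  by_cases h : i = j
  · simp [h, divDiff]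
  refine LinearMap.ext fun f => ?_
  apply mul_left_cancel₀ (X_sub_X_ne_zero (k := k) h)
  simp only [Module.End.mul_apply, X_sub_X_mul_divDiff h, xMul,
    LinearMap.mulLeft_apply, permX_apply_mul, permX_X, Equiv.swap_apply_of_ne_of_ne hi hj]
  linear_combination (-(X l : BosPoly k N)) * X_sub_X_mul_divDiff h f

theorem dunkl_mul_xMul_of_ne (β : k) {i j : Fin N} (h : i ≠ j) :
    dunkl β i * xMul j = xMul j * dunkl β i - β • permX (Equiv.swap i j) := by
  have hj : j ∈ Finset.univ.erase i := by simp [h.symm]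
  rw [dunkl, add_mul, mul_add, dX_mul_xMul, if_neg h, smul_mul_assoc, mul_smul_comm,
    ← Finset.add_sum_erase _ _ hj, add_mul, mul_add, divDiff_mul_xMul_right h, Finset.sum_mul,
    Finset.mul_sum]
  rw [Finset.sum_congr rfl fun l hl => divDiff_mul_xMul_of_ne (k := k) h.symm
    (Finset.ne_of_mem_erase hl).symm]
  module

theorem dunkl_mul_xMul_self (β : k) (i : Fin N) :
    dunkl β i * xMul i =
      xMul i * dunkl β i + 1 + β • ∑ l ∈ Finset.univ.erase i, permX (Equiv.swap i l) := by
  rw [dunkl, add_mul, mul_add, dX_mul_xMul, if_pos rfl, smul_mul_assoc, mul_smul_comm,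
    Finset.sum_mul, Finset.mul_sum]
  rw [Finset.sum_congr rfl fun l hl => divDiff_mul_xMul_left (k := k)
    (Finset.ne_of_mem_erase hl).symm, Finset.sum_add_distrib]
  module

theorem xMul_mul_xMul (i j : Fin N) :
    (xMul i * xMul j : Module.End k (BosPoly k N)) = xMul j * xMul i := by
  refine LinearMap.ext fun f => ?_
  simp only [xMul, Module.End.mul_apply, LinearMap.mulLeft_apply]
  ring

theorem dunkl_one (β : k) (i : Fin N) : dunkl β i (1 : BosPoly k N) = 0 := by
  rcases dunkl_totalDegree β i (1 : BosPoly k N) 0 (by simp) with h | h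
  · exact h
  · omega

/-- An operator that commutes with the `x_j` and kills `1` vanishes. -/
theorem eq_zero_of_commute_xMul (T : Module.End k (BosPoly k N))
    (hT : ∀ j, T * xMul j = xMul j * T) (h1 : T 1 = 0) : T = 0 := by
  refine LinearMap.ext fun f => ?_
  induction f using MvPolynomial.induction_on with
  | C a => rw [C_eq_smul_one, map_smul, h1]; simp
  | add p q hp hq => rw [map_add, hp, hq]; simp
  | mul_X p j hp =>
    have := LinearMap.congr_fun (hT j) p
    simp only [xMul, Module.End.mul_apply, LinearMap.mulLeft_apply, hp] at this
    rw [mul_comm, this]; simp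

theorem permX_swap_mul_dunkl_of_ne (β : k) {i j l : Fin N} (hi : l ≠ i) (hj : l ≠ j) :
    permX (Equiv.swap i j) * dunkl β l = dunkl β l * permX (Equiv.swap i j) := by
  rw [permX_mul_dunkl, Equiv.swap_apply_of_ne_of_ne hi hj]

/-- The commutator `[D_i, D_j]` kills `1` and commutes with every `x_l`, so it vanishes by
`eq_zero_of_commute_xMul`. Only the commutation rules with `x` and `K` enter, never the rational
functions themselves. -/
theorem dunkl_mul_dunkl (β : k) (i j : Fin N) :
    dunkl β i * dunkl β j = dunkl β j * dunkl β i := by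
  by_cases h : i = j
  · rw [h]
  have key : ∀ i j l : Fin N, i ≠ j → i ≠ l → j ≠ l →
      dunkl β i * dunkl β j * xMul l = xMul l * (dunkl β i * dunkl β j)
        - β • (dunkl β i * permX (Equiv.swap j l)) - β • (dunkl β j * permX (Equiv.swap i l)) := by
    intro i j l hij hil hjl
    rw [mul_assoc, dunkl_mul_xMul_of_ne β hjl, mul_sub, ← mul_assoc, dunkl_mul_xMul_of_ne β hil,
      sub_mul, smul_mul_assoc, mul_smul_comm,
      permX_swap_mul_dunkl_of_ne β hij.symm hjl, mul_assoc]
    module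
  have key2 : ∀ i j : Fin N, i ≠ j →
      (dunkl β i * dunkl β j - dunkl β j * dunkl β i) * xMul i
        = xMul i * (dunkl β i * dunkl β j - dunkl β j * dunkl β i) := by
    intro i j hij
    have hj : j ∈ Finset.univ.erase i := by simp [hij.symm]
    have hc : (∑ l ∈ (Finset.univ.erase i).erase j, permX (Equiv.swap i l)) * dunkl β j
        = dunkl β j * ∑ l ∈ (Finset.univ.erase i).erase j, permX (Equiv.swap i l) := by
      rw [Finset.sum_mul, Finset.mul_sum]
      refine Finset.sum_congr rfl fun l hl => permX_swap_mul_dunkl_of_ne β hij.symm ?_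
      exact (Finset.ne_of_mem_erase hl).symm
    have e1 : permX (Equiv.swap i j) * dunkl β j = dunkl β i * permX (Equiv.swap i j) := by
      rw [permX_mul_dunkl, Equiv.swap_apply_right]
    have e2 : permX (Equiv.swap j i) = (permX (Equiv.swap i j) : Module.End k (BosPoly k N)) := by
      rw [Equiv.swap_comm]
    rw [sub_mul, mul_assoc, mul_assoc, dunkl_mul_xMul_of_ne β hij.symm, dunkl_mul_xMul_self,
      ← Finset.add_sum_erase _ _ hj, mul_sub, ← mul_assoc, dunkl_mul_xMul_self, mul_add, mul_add,
      ← mul_assoc, dunkl_mul_xMul_of_ne β hij.symm, ← Finset.add_sum_erase _ _ hj, add_mul,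
      add_mul, sub_mul, smul_mul_assoc, smul_mul_assoc, add_mul, hc, e1, e2, mul_smul_comm,
      mul_smul_comm, mul_add, permX_mul_dunkl, Equiv.swap_apply_left, mul_sub, ← mul_assoc,
      ← mul_assoc]
    simp only [one_mul, mul_one]
    module
  rw [← sub_eq_zero]
  refine eq_zero_of_commute_xMul _ (fun l => ?_) ?_
  · by_cases hi : i = l
    · subst hi
      exact key2 i j h
    -- The case of `x_j` is that of `x_i` with the two indices exchanged, which changes the sign of
    -- the commutator.
    · by_cases hj : j = l
      · subst hj
        have := key2 j i (Ne.symm h)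
        rw [sub_mul, mul_sub] at this ⊢
        exact neg_injective (by simpa only [neg_sub] using this)
      · rw [sub_mul, key i j l h hi hj, key j i l (Ne.symm h) hj hi, mul_sub]
        module
  · simp [dunkl_one]

/-! ## Two-variable identities -/

section Pairs

variable {A : Type*} [Ring A]

/-- Newton's recurrence expresses each power sum of two commuting elements through their sum and
product. -/
theorem commute_pow_add_pow {s a b : A} (hab : Commute a b) (hs : Commute s (a + b))
    (hp : Commute s (a * b)) (n : ℕ) : Commute s (a ^ n + b ^ n) := by
  induction n using Nat.twoStepInduction with
  | zero => simp
  | one => simpa using hs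
  | more n h0 h1 =>
    have e : a ^ (n + 2) + b ^ (n + 2) =
        (a + b) * (a ^ (n + 1) + b ^ (n + 1)) - a * b * (a ^ n + b ^ n) := by
      have h2 : a * b * b ^ n = a * b ^ (n + 1) := by rw [pow_succ', mul_assoc]
      have h3 : a * b * a ^ n = b * a ^ (n + 1) := by rw [hab.eq, pow_succ', mul_assoc]
      rw [mul_add (a * b), h2, h3, pow_succ' a (n + 1), pow_succ' b (n + 1)]
      noncomm_ring
    rw [e]
    exact (hs.mul_right h1).sub_right (hp.mul_right h0)

/-- If `[a, b] = (a - b) κ` where `κ` intertwines `a` and `b`, then the sum of the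
commutators `[a ^ m, b ^ n]` and `[b ^ m, a ^ n]` vanishes. -/
theorem lie_pow_add_lie_pow {a b κ : A} (hab : a * b - b * a = (a - b) * κ)
    (hκa : κ * a = b * κ) (hκb : κ * b = a * κ) (m n : ℕ) :
    (a ^ m * b ^ n - b ^ n * a ^ m) + (b ^ m * a ^ n - a ^ n * b ^ m) = 0 := by
  -- With this choice `a` and `b` commute with `s` and `p`, and both are roots of `t² - s t + p`. So
  -- `a` and `b` behave like two roots of one quadratic with central coefficients, although they do
  -- not commute with each other.
  set s := a + b - κ with hs
  set p := a * s - a * a with hp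
  have hab' : a * b = b * a + (a * κ - b * κ) := by rw [← sub_mul, ← hab]; abel
  have hsa : Commute a s := by
    rw [Commute, SemiconjBy, hs, mul_sub, mul_add, sub_mul, add_mul, hκa, hab']
    abel
  have hsb : Commute b s := by
    rw [Commute, SemiconjBy, hs, mul_sub, mul_add, sub_mul, add_mul, hκb, hab']
    abel
  have hpb : p = b * s - b * b := by
    rw [hp, hs, mul_sub, mul_add, mul_sub, mul_add, hab']
    abel
  have hpa : Commute a p :=
    ((Commute.refl a).mul_right hsa).sub_right ((Commute.refl a).mul_right (Commute.refl a))
  have hpb' : Commute b p := by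
    rw [hpb]
    exact ((Commute.refl b).mul_right hsb).sub_right ((Commute.refl b).mul_right (Commute.refl b))
  have hps : Commute p s := ((hsa.mul_left (Commute.refl s))).sub_left (hsa.mul_left hsa)
  have hcl : ∀ {c z : A}, Commute c s → Commute c p →
      z ∈ Subring.closure {s, p} → Commute z c := by
    intro c z h1 h2 hz
    have : Subring.closure {s, p} ≤ Subring.centralizer {c} := by
      rw [Subring.closure_le]
      rintro y (rfl | rfl)
      · exact Subring.mem_centralizer_iff.2 fun g hg => by rw [Set.mem_singleton_iff.1 hg]; exact h1
      · exact Subring.mem_centralizer_iff.2 fun g hg => by rw [Set.mem_singleton_iff.1 hg]; exact h2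
    exact (Subring.mem_centralizer_iff.1 (this hz) c rfl).symm
  have hcomm : ∀ {y z : A}, y ∈ Subring.closure {s, p} → z ∈ Subring.closure {s, p} →
      Commute y z := fun hy hz =>
    hcl (hcl (Commute.refl s) hps.symm hz) (hcl hps (Commute.refl p) hz) hy
  -- Reduction modulo the common quadratic yields the same `u`, `v` for `a` and for `b`. The
  -- commutators `[a^m, b^n]` and `[b^m, a^n]` are therefore `u u' [a, b]` and `u u' [b, a]`, which
  -- cancel.
  have hpow : ∀ n : ℕ, ∃ u ∈ Subring.closure {s, p}, ∃ v ∈ Subring.closure {s, p},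
      a ^ n = u * a + v ∧ b ^ n = u * b + v := by
    intro n
    induction n with
    | zero => exact ⟨0, zero_mem _, 1, one_mem _, by simp, by simp⟩
    | succ n ih =>
      obtain ⟨u, hu, v, hv, ha, hb⟩ := ih
      have hsm : s ∈ Subring.closure {s, p} := Subring.subset_closure (by simp)
      have hpm : p ∈ Subring.closure {s, p} := Subring.subset_closure (by simp)
      refine ⟨u * s + v, add_mem (mul_mem hu hsm) hv, -(u * p), neg_mem (mul_mem hu hpm), ?_, ?_⟩
      · rw [pow_succ, ha, hp, hsa.eq]
        noncomm_ring
      · rw [pow_succ, hb, hpb, hsb.eq]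
        noncomm_ring
  obtain ⟨u, hu, v, hv, ha, hb⟩ := hpow m
  obtain ⟨u', hu', v', hv', ha', hb'⟩ := hpow n
  have expand : ∀ {u v u' v' c d : A}, u' ∈ Subring.closure {s, p} →
      v' ∈ Subring.closure {s, p} → Commute c s → Commute c p →
      (u * c + v) * (u' * d + v') = u * u' * (c * d) + u * v' * c + v * u' * d + v * v' := by
    intro u v u' v' c d hu' hv' h1 h2
    have e1 := (hcl h1 h2 hu').eq
    have e2 := (hcl h1 h2 hv').eq
    calc (u * c + v) * (u' * d + v')
        = u * (c * u') * d + u * (c * v') + v * u' * d + v * v' := by noncomm_ring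
      _ = _ := by rw [← e1, ← e2]; noncomm_ring
  rw [ha, hb, ha', hb', expand hu' hv' hsa hpa, expand hu hv hsb hpb', expand hu' hv' hsb hpb',
    expand hu hv hsa hpa, (hcomm hu' hu).eq, (hcomm hu' hv).eq, (hcomm hv' hu).eq,
    (hcomm hv' hv).eq]
  abel

end Pairs

/-! ## The algebra of coordinates, Dunkl operators and permutations -/

section Rel

variable {A : Type*} [Ring A] [Algebra k A]

/-- The relations of the rational Cherednik algebra of type `A`. -/
structure DunklRel (β : k) (x D : Fin N → A) (K : Equiv.Perm (Fin N) →* A) : Prop where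
  x_mul_x : ∀ i j, x i * x j = x j * x i
  D_mul_D : ∀ i j, D i * D j = D j * D i
  K_mul_x : ∀ w j, K w * x j = x (w j) * K w
  K_mul_D : ∀ w j, K w * D j = D (w j) * K w
  D_mul_x_of_ne : ∀ {i j}, i ≠ j → D i * x j = x j * D i - β • K (Equiv.swap i j)
  D_mul_x_self : ∀ i, D i * x i =
    x i * D i + 1 + β • ∑ l ∈ Finset.univ.erase i, K (Equiv.swap i l)

theorem dunklRel (β : k) : DunklRel β (xMul : Fin N → _) (dunkl β) permXHom where
  x_mul_x := xMul_mul_xMul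
  D_mul_D := dunkl_mul_dunkl β
  K_mul_x := permX_mul_xMul
  K_mul_D := permX_mul_dunkl β
  D_mul_x_of_ne := dunkl_mul_xMul_of_ne β
  D_mul_x_self := dunkl_mul_xMul_self β

/-- `x_j D_j + β ∑_{l > j} K_{jl} - c`. -/
def cherednik (β c : k) (x D : Fin N → A) (K : Equiv.Perm (Fin N) →* A) (j : Fin N) : A :=
  x j * D j + β • ∑ l ∈ Finset.univ.filter (fun l => j < l), K (Equiv.swap j l) - c • (1 : A)

/-- `D_j x_j - 1 - c = x_j D_j + β ∑_{l ≠ j} K_{jl} - c`. -/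
def heckman (c : k) (x D : Fin N → A) (j : Fin N) : A := D j * x j - (1 + c) • (1 : A)

/-- `∑_{l < j} K_{jl}`. -/
def jucysMurphy (K : Equiv.Perm (Fin N) →* A) (j : Fin N) : A :=
  ∑ l ∈ Finset.univ.filter (fun l => l < j), K (Equiv.swap j l)

theorem map_mul_map_swap (K : Equiv.Perm (Fin N) →* A) (w : Equiv.Perm (Fin N)) (i j : Fin N) :
    K w * K (Equiv.swap i j) = K (Equiv.swap (w i) (w j)) * K w := by
  rw [← map_mul, ← map_mul, Equiv.mul_swap_eq_swap_mul]

theorem map_mul_jucysMurphy (K : Equiv.Perm (Fin N) →* A) {w : Equiv.Perm (Fin N)} {j : Fin N}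
    (hj : w j = j) (hw : ∀ l, l < j ↔ w l < j) :
    K w * jucysMurphy K j = jucysMurphy K j * K w := by
  rw [jucysMurphy, Finset.mul_sum, Finset.sum_mul]
  refine Finset.sum_equiv w (by simpa using hw) fun l _ => ?_
  rw [map_mul_map_swap, hj]

theorem swap_lt_iff {i l j m : Fin N} (hi : i < j) (hl : l < j) :
    m < j ↔ Equiv.swap i l m < j := by
  rw [Equiv.swap_apply_def]
  split_ifs with h1 h2
  · simp [h1, hi, hl]
  · simp [h2, hi, hl]
  · rfl

/-- For `i < j`, every transposition occurring in the sum for `i` fixes `j` and preserves `{l | l <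
j}`, so it commutes with the whole sum for `j`. -/
theorem jucysMurphy_mul_jucysMurphy (K : Equiv.Perm (Fin N) →* A) (i j : Fin N) :
    jucysMurphy K i * jucysMurphy K j = jucysMurphy K j * jucysMurphy K i := by
  wlog h : i < j generalizing i j
  · rcases (not_lt.1 h).eq_or_lt with rfl | h'
    · rfl
    · exact (this j i h').symm
  conv_lhs => rw [jucysMurphy, Finset.sum_mul]
  conv_rhs => rw [jucysMurphy.eq_1 K i, Finset.mul_sum]
  refine Finset.sum_congr rfl fun l hl => ?_
  have hl' : l < i := by simpa using hl
  exact map_mul_jucysMurphy K (Equiv.swap_apply_of_ne_of_ne h.ne' (hl'.trans h).ne')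
    fun m => swap_lt_iff h (hl'.trans h)

theorem univ_erase_eq (j : Fin N) : Finset.univ.erase j =
    (Finset.univ.filter fun l => l < j) ∪ Finset.univ.filter fun l => j < l := by
  ext l
  simp [lt_or_lt_iff_ne]

theorem sum_univ_erase {M : Type*} [AddCommMonoid M] (j : Fin N) (g : Fin N → M) :
    ∑ l ∈ Finset.univ.erase j, g l = ∑ l ∈ Finset.univ.filter (fun l => l < j), g l +
      ∑ l ∈ Finset.univ.filter (fun l => j < l), g l := by
  rw [univ_erase_eq, Finset.sum_union]
  rw [Finset.disjoint_filter]
  exact fun l _ h => h.not_gt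

namespace DunklRel

variable {β c : k} {x D : Fin N → A} {K : Equiv.Perm (Fin N) →* A}

theorem map (h : DunklRel β x D K) {B : Type*} [Ring B] [Algebra k B] (φ : A →ₐ[k] B) :
    DunklRel β (φ ∘ x) (φ ∘ D) ((φ : A →* B).comp K) where
  x_mul_x i j := by simp only [Function.comp_apply, ← map_mul, h.x_mul_x i j]
  D_mul_D i j := by simp only [Function.comp_apply, ← map_mul, h.D_mul_D i j]
  K_mul_x w j := by
    simp only [Function.comp_apply, MonoidHom.comp_apply, MonoidHom.coe_coe, ← map_mul, h.K_mul_x]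
  K_mul_D w j := by
    simp only [Function.comp_apply, MonoidHom.comp_apply, MonoidHom.coe_coe, ← map_mul, h.K_mul_D]
  D_mul_x_of_ne hij := by
    simp only [Function.comp_apply, MonoidHom.comp_apply, MonoidHom.coe_coe, ← map_mul,
      h.D_mul_x_of_ne hij, map_sub, map_smul]
  D_mul_x_self i := by
    simp only [Function.comp_apply, MonoidHom.comp_apply, MonoidHom.coe_coe, ← map_mul,
      h.D_mul_x_self i, map_add, map_smul, map_sum, map_one]

/-- The shifted coordinates still commute because `[D_i, x_j] = -β K_{ij}` is symmetric in `i ≠ j`.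
The mixed relations persist because the `D_j` commute among themselves. -/
theorem sub_smul (h : DunklRel β x D K) (γ : k) :
    DunklRel β (fun j => x j - γ • D j) D K where
  x_mul_x i j := by
    by_cases hij : i = j
    · rw [hij]
    simp only [sub_mul, mul_sub, smul_mul_assoc, mul_smul_comm, h.D_mul_x_of_ne hij,
      h.D_mul_x_of_ne (Ne.symm hij), h.x_mul_x j i, h.D_mul_D j i, Equiv.swap_comm j i]
    module
  D_mul_D := h.D_mul_D
  K_mul_x w j := by
    simp only [sub_mul, mul_sub, smul_mul_assoc, mul_smul_comm, h.K_mul_x, h.K_mul_D]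
  K_mul_D := h.K_mul_D
  D_mul_x_of_ne {i j} hij := by
    simp only [sub_mul, mul_sub, smul_mul_assoc, mul_smul_comm, h.D_mul_x_of_ne hij,
      h.D_mul_D i j]
    module
  D_mul_x_self i := by
    simp only [sub_mul, mul_sub, smul_mul_assoc, mul_smul_comm, h.D_mul_x_self]
    module

/-- The commutator of `∑ D_i ^ 2` with `x_j`. -/
theorem sum_D_sq_mul_x (h : DunklRel β x D K) (j : Fin N) :
    (∑ i, D i ^ 2) * x j = x j * ∑ i, D i ^ 2 + (2 : k) • D j := by
  -- The permutation terms produced here for `i ≠ j` are exactly those produced with opposite sign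
  -- by `D_j²`; only `2 D_j` survives.
  have hne : ∀ i ∈ Finset.univ.erase j, D i ^ 2 * x j = x j * D i ^ 2
      - β • (D i * K (Equiv.swap j i) + D j * K (Equiv.swap j i)) := by
    intro i hi
    have hij : i ≠ j := Finset.ne_of_mem_erase hi
    have h1 : K (Equiv.swap i j) * D i = D j * K (Equiv.swap i j) := by
      rw [h.K_mul_D, Equiv.swap_apply_left]
    rw [pow_two, mul_assoc, h.D_mul_x_of_ne hij, mul_sub, ← mul_assoc, h.D_mul_x_of_ne hij, sub_mul,
      mul_smul_comm, smul_mul_assoc, h1, Equiv.swap_comm i j, mul_assoc]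
    module
  have heq : D j ^ 2 * x j = x j * D j ^ 2 + (2 : k) • D j + β • ∑ i ∈ Finset.univ.erase j,
      (D i * K (Equiv.swap j i) + D j * K (Equiv.swap j i)) := by
    have h1 : (∑ i ∈ Finset.univ.erase j, K (Equiv.swap j i)) * D j =
        ∑ i ∈ Finset.univ.erase j, D i * K (Equiv.swap j i) := by
      rw [Finset.sum_mul]
      exact Finset.sum_congr rfl fun i _ => by rw [h.K_mul_D, Equiv.swap_apply_left]
    rw [pow_two, mul_assoc, h.D_mul_x_self, mul_add, mul_add, ← mul_assoc, h.D_mul_x_self, add_mul,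
      add_mul, mul_smul_comm, smul_mul_assoc, h1, Finset.sum_add_distrib, Finset.mul_sum, mul_one,
      one_mul, mul_assoc]
    module
  rw [← Finset.add_sum_erase _ _ (Finset.mem_univ j), add_mul, Finset.sum_mul,
    Finset.sum_congr rfl hne, heq, Finset.sum_sub_distrib, mul_add, Finset.mul_sum,
    ← Finset.smul_sum]
  abel

theorem commute_sum_D_sq_D (h : DunklRel β x D K) (j : Fin N) : Commute (∑ i, D i ^ 2) (D j) :=
  Commute.sum_left _ _ _ fun i _ => Commute.pow_left (h.D_mul_D i j) 2

theorem commute_sum_D_sq_K (h : DunklRel β x D K) (w : Equiv.Perm (Fin N)) :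
    Commute (∑ i, D i ^ 2) (K w) := by
  rw [Commute, SemiconjBy, Finset.mul_sum, Finset.sum_mul]
  refine (Finset.sum_equiv w (by simp) fun i _ => ?_).symm
  rw [pow_two, pow_two, ← mul_assoc, h.K_mul_D, mul_assoc, h.K_mul_D, mul_assoc]

theorem cherednik_eq (h : DunklRel β x D K) (j : Fin N) :
    cherednik β c x D K j = heckman c x D j - β • jucysMurphy K j := by
  rw [cherednik, heckman, jucysMurphy, h.D_mul_x_self, sum_univ_erase]
  module

theorem K_mul_heckman (h : DunklRel β x D K) (w : Equiv.Perm (Fin N)) (j : Fin N) :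
    K w * heckman c x D j = heckman c x D (w j) * K w := by
  rw [heckman, heckman, mul_sub, sub_mul, ← mul_assoc, h.K_mul_D, mul_assoc, h.K_mul_x,
    ← mul_assoc, mul_smul_comm, smul_mul_assoc, one_mul, mul_one]

/-- Moving `x_i` past `D_j` in `D_i x_i D_j x_j` leaves `D_i D_j x_i x_j`, symmetric in `i` and `j`,
plus the term `β D_i x_i K_{ij}`. -/
theorem lie_heckman (h : DunklRel β x D K) (i j : Fin N) :
    heckman c x D i * heckman c x D j - heckman c x D j * heckman c x D i =
      (heckman c x D i - heckman c x D j) * (β • K (Equiv.swap i j)) := by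
  by_cases hij : i = j
  · simp [hij]
  have e : ∀ {i j}, i ≠ j → D i * x i * (D j * x j) =
      D i * D j * (x i * x j) + β • (D i * x i * K (Equiv.swap i j)) := by
    intro i j hij
    have h1 : x i * D j = D j * x i + β • K (Equiv.swap i j) := by
      rw [h.D_mul_x_of_ne hij.symm, Equiv.swap_comm]; abel
    have h2 : K (Equiv.swap i j) * x j = x i * K (Equiv.swap i j) := by
      rw [h.K_mul_x, Equiv.swap_apply_right]
    calc D i * x i * (D j * x j) = D i * (x i * D j) * x j := by noncomm_ring
      _ = D i * D j * (x i * x j) + β • (D i * (K (Equiv.swap i j) * x j)) := by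
        rw [h1, mul_add, add_mul, mul_smul_comm, smul_mul_assoc]
        simp only [mul_assoc]
      _ = _ := by simp only [h2, mul_assoc]
  have e1 := e hij
  have e2 := e (Ne.symm hij)
  rw [h.D_mul_D j i, h.x_mul_x j i, Equiv.swap_comm] at e2
  simp only [heckman, mul_sub, sub_mul, e1, e2, mul_smul_comm, smul_mul_assoc, mul_one, one_mul]
  module

theorem lie_heckman_pow (h : DunklRel β x D K) (i j : Fin N) (m n : ℕ) :
    (heckman c x D i ^ m * heckman c x D j ^ n - heckman c x D j ^ n * heckman c x D i ^ m) +
      (heckman c x D j ^ m * heckman c x D i ^ n - heckman c x D i ^ n * heckman c x D j ^ m)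
      = 0 := by
  refine lie_pow_add_lie_pow (h.lie_heckman i j) ?_ ?_ m n
  · rw [smul_mul_assoc, h.K_mul_heckman, Equiv.swap_apply_left, mul_smul_comm]
  · rw [smul_mul_assoc, h.K_mul_heckman, Equiv.swap_apply_right, mul_smul_comm]

/-- For `i < j` the Jucys-Murphy corrections repair the failure of the Heckman operators to commute:
`[E_i, J_j] = (E_i - E_j) K_{ij}` cancels `[E_i, E_j]`, while `[J_i, E_j]` and `[J_i, J_j]` vanish.
-/
theorem cherednik_mul_cherednik (h : DunklRel β x D K) (i j : Fin N) :
    cherednik β c x D K i * cherednik β c x D K j =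
      cherednik β c x D K j * cherednik β c x D K i := by
  wlog hij : i < j generalizing i j
  · rcases (not_lt.1 hij).eq_or_lt with rfl | h'
    · rfl
    · exact (this j i h').symm
  rw [h.cherednik_eq, h.cherednik_eq]
  have hj : heckman c x D i * jucysMurphy K j - jucysMurphy K j * heckman c x D i
      = (heckman c x D i - heckman c x D j) * K (Equiv.swap i j) := by
    have hi : i ∈ Finset.univ.filter (fun l => l < j) := by simpa using hij
    have h0 : K (Equiv.swap j i) * heckman c x D i = heckman c x D j * K (Equiv.swap j i) := by
      rw [h.K_mul_heckman, Equiv.swap_apply_right]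
    have h1 : ∀ l ∈ (Finset.univ.filter (fun l => l < j)).erase i,
        K (Equiv.swap j l) * heckman c x D i = heckman c x D i * K (Equiv.swap j l) := by
      intro l hl
      rw [h.K_mul_heckman, Equiv.swap_apply_of_ne_of_ne hij.ne (Finset.ne_of_mem_erase hl).symm]
    rw [jucysMurphy, ← Finset.add_sum_erase _ _ hi, mul_add, add_mul, Finset.mul_sum,
      Finset.sum_mul, Finset.sum_congr rfl h1, h0, Equiv.swap_comm i j, sub_mul]
    abel
  have hi : jucysMurphy K i * heckman c x D j = heckman c x D j * jucysMurphy K i := by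
    rw [jucysMurphy, Finset.mul_sum, Finset.sum_mul]
    refine Finset.sum_congr rfl fun l hl => ?_
    have hl' : l < i := by simpa using hl
    rw [h.K_mul_heckman, Equiv.swap_apply_of_ne_of_ne hij.ne' (hl'.trans hij).ne']
  have h1 := h.lie_heckman (c := c) i j
  rw [mul_smul_comm, ← hj] at h1
  have h2 := jucysMurphy_mul_jucysMurphy K i j
  rw [← sub_eq_zero]
  simp only [sub_mul, mul_sub, smul_mul_assoc, mul_smul_comm, hi, h2]
  rw [← sub_eq_zero] at h1
  rw [← h1]
  module

theorem K_mul_cherednik (h : DunklRel β x D K) {w : Equiv.Perm (Fin N)} {j : Fin N}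
    (hj : w j = j) (hw : ∀ l, l < j ↔ w l < j) :
    K w * cherednik β c x D K j = cherednik β c x D K j * K w := by
  rw [h.cherednik_eq, mul_sub, sub_mul, h.K_mul_heckman, mul_smul_comm, smul_mul_assoc,
    map_mul_jucysMurphy K hj hw, hj]

/-- This is the degenerate affine Hecke relation. For adjacent indices the Jucys-Murphy sum for `j`
is the conjugate of the one for `i` plus the single extra term `K_{ij}`, whose square is `1`. -/
theorem K_swap_mul_cherednik (h : DunklRel β x D K) {i j : Fin N} (hij : (i : ℕ) + 1 = j) :
    K (Equiv.swap i j) * cherednik β c x D K i =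
      cherednik β c x D K j * K (Equiv.swap i j) + β • (1 : A) := by
  have hlt : i < j := Fin.lt_def.2 (by omega)
  have hset : (Finset.univ.filter fun l => l < j) =
      insert i (Finset.univ.filter fun l => l < i) := by
    ext l
    simp only [Finset.mem_filter, Finset.mem_univ, true_and, Finset.mem_insert, Fin.lt_def,
      Fin.ext_iff]
    omega
  have h1 : jucysMurphy K j * K (Equiv.swap i j) =
      1 + K (Equiv.swap i j) * jucysMurphy K i := by
    rw [jucysMurphy, hset, Finset.sum_insert (by simp), add_mul, Equiv.swap_comm j i, ← map_mul,
      Equiv.swap_mul_self, map_one, jucysMurphy, Finset.mul_sum, Finset.sum_mul]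
    congr 1
    refine Finset.sum_congr rfl fun l hl => ?_
    have hl' : l < i := by simpa using hl
    rw [map_mul_map_swap K (Equiv.swap i j), Equiv.swap_apply_left,
      Equiv.swap_apply_of_ne_of_ne hl'.ne (hl'.trans hlt).ne]
  rw [h.cherednik_eq, h.cherednik_eq, mul_sub, sub_mul, h.K_mul_heckman, Equiv.swap_apply_left,
    mul_smul_comm, smul_mul_assoc, h1]
  module

theorem commute_K_swap_sum_cherednik_pow (h : DunklRel β x D K) {i j : Fin N}
    (hij : (i : ℕ) + 1 = j) (n : ℕ) :
    Commute (K (Equiv.swap i j)) (∑ l, cherednik β c x D K l ^ n) := by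
  have hne : i ≠ j := fun e => by rw [e] at hij; omega
  have hsq : K (Equiv.swap i j) * K (Equiv.swap i j) = 1 := by
    rw [← map_mul, Equiv.swap_mul_self, map_one]
  have e1 := h.K_swap_mul_cherednik (c := c) hij
  -- Multiplying `e1` by the involution on both sides gives the companion relation. The `β` terms
  -- then cancel in the sum and in the product of the two operators, so `commute_pow_add_pow`
  -- applies.
  have e2 : K (Equiv.swap i j) * cherednik β c x D K j =
      cherednik β c x D K i * K (Equiv.swap i j) - β • (1 : A) := by
    have h1 := congrArg (fun z => K (Equiv.swap i j) * z * K (Equiv.swap i j)) e1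
    simp only [mul_add, add_mul, mul_smul_comm, smul_mul_assoc, mul_one, hsq] at h1
    rw [← mul_assoc, hsq, one_mul, ← mul_assoc, mul_assoc _ (K _) (K _), hsq, mul_one] at h1
    rw [h1]
    abel
  have hj : j ∈ Finset.univ.erase i := by simp [hne.symm]
  rw [← Finset.add_sum_erase _ _ (Finset.mem_univ i), ← Finset.add_sum_erase _ _ hj, ← add_assoc]
  refine Commute.add_right ?_ (Commute.sum_right _ _ _ fun l hl => Commute.pow_right ?_ n)
  · refine commute_pow_add_pow (h.cherednik_mul_cherednik i j) ?_ ?_ n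
    · rw [Commute, SemiconjBy, mul_add, add_mul, e1, e2]
      abel
    · rw [Commute, SemiconjBy, ← mul_assoc, e1, add_mul, mul_assoc, e2, mul_sub, mul_smul_comm,
        smul_mul_assoc, mul_one, one_mul, h.cherednik_mul_cherednik i j, mul_assoc]
      abel
  · have hlj : l ≠ j := Finset.ne_of_mem_erase hl
    have hli : l ≠ i := Finset.ne_of_mem_erase (Finset.mem_of_mem_erase hl)
    refine h.K_mul_cherednik (Equiv.swap_apply_of_ne_of_ne hli hlj) fun m => ?_
    rw [Equiv.swap_apply_def]
    simp only [ne_eq, Fin.ext_iff] at hli hlj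
    split_ifs with h1 h2 <;> simp only [Fin.lt_def, Fin.ext_iff] at * <;> omega

/-- Adjacent transpositions generate the symmetric group, so the Hecke relation suffices. -/
theorem commute_K_sum_cherednik_pow (h : DunklRel β x D K) (w : Equiv.Perm (Fin N)) (n : ℕ) :
    Commute (K w) (∑ j, cherednik β c x D K j ^ n) := by
  cases N with
  | zero => rw [Subsingleton.elim w 1, map_one]; exact Commute.one_left _
  | succ N =>
    have hw : w ∈ Submonoid.closure
        (Set.range fun i : Fin N => Equiv.swap i.castSucc i.succ) := by
      rw [Equiv.Perm.mclosure_swap_castSucc_succ]; trivial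
    induction hw using Submonoid.closure_induction with
    | mem v hv =>
      obtain ⟨i, rfl⟩ := hv
      exact h.commute_K_swap_sum_cherednik_pow (by simp) n
    | one => rw [map_one]; exact Commute.one_left _
    | mul u v _ _ hu hv => rw [map_mul]; exact hu.mul_left hv

end DunklRel

end Rel

/-! ## Operators on superpolynomials -/

/-- `liftX` as an algebra homomorphism. -/
def liftXHom : Module.End k (BosPoly k N) →ₐ[k] Module.End k (SuperPoly k N) :=
  Module.End.rTensorAlgHom k (BosPoly k N) (Grass k N)

theorem liftXHom_apply (T : Module.End k (BosPoly k N)) : liftXHom T = liftX T := rfl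

theorem liftTheta_mul (S T : Module.End k (Grass k N)) :
    (liftTheta (S * T) : Module.End k (SuperPoly k N)) = liftTheta S * liftTheta T :=
  LinearMap.lTensor_mul _ _ _

theorem commute_liftTheta_liftX (S : Module.End k (Grass k N))
    (T : Module.End k (BosPoly k N)) : Commute (liftTheta S) (liftX T) := by
  rw [Commute, SemiconjBy, Module.End.mul_eq_comp, Module.End.mul_eq_comp, liftTheta, liftX,
    LinearMap.lTensor_comp_rTensor, LinearMap.rTensor_comp_lTensor]

theorem permTheta_mul_permTheta (v w : Equiv.Perm (Fin N)) :
    (permTheta (v * w) : Module.End k (Grass k N)) = permTheta v * permTheta w := by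
  rw [permTheta, permTheta, permTheta, Equiv.Perm.coe_mul, Finsupp.lmapDomain_comp,
    ← ExteriorAlgebra.map_comp_map]
  rfl

theorem permTheta_mul_thetaMul (w : Equiv.Perm (Fin N)) (j : Fin N) :
    (permTheta w * thetaMul j : Module.End k (Grass k N)) = thetaMul (w j) * permTheta w := by
  refine LinearMap.ext fun f => ?_
  simp [permTheta, thetaMul]

theorem permTheta_mul_dTheta (w : Equiv.Perm (Fin N)) (j : Fin N) :
    (permTheta w * dTheta j : Module.End k (Grass k N)) = dTheta (w j) * permTheta w := by
  refine LinearMap.ext fun f => ?_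
  induction f using CliffordAlgebra.left_induction with
  | algebraMap r =>
    have h1 : permTheta w (algebraMap k (Grass k N) r) = algebraMap k (Grass k N) r := by
      simp [permTheta]
    have h2 : ∀ i : Fin N, dTheta i (algebraMap k (Grass k N) r) = 0 := fun i =>
      CliffordAlgebra.contractLeft_algebraMap _ _ r
    exact (congrArg (permTheta w) (h2 j)).trans
      ((map_zero _).trans ((congrArg (dTheta (w j)) h1).trans (h2 _)).symm)
  | add f g hf hg => rw [map_add, map_add, hf, hg]
  | ι_mul f m hf =>
    have h1 : ∀ (m : Fin N →₀ k) (f : Grass k N), permTheta w (ExteriorAlgebra.ι k m * f) =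
        ExteriorAlgebra.ι k (m.mapDomain w) * permTheta w f := by
      intro m f
      simp [permTheta]
    have h2 : ∀ (i : Fin N) (m : Fin N →₀ k) (f : Grass k N),
        dTheta i (ExteriorAlgebra.ι k m * f) = m i • f - ExteriorAlgebra.ι k m * dTheta i f :=
      fun i m f => CliffordAlgebra.contractLeft_ι_mul _ _ _
    change permTheta w (dTheta j (ExteriorAlgebra.ι k m * f)) =
      dTheta (w j) (permTheta w (ExteriorAlgebra.ι k m * f))
    have h3 : permTheta w (dTheta j f) = dTheta (w j) (permTheta w f) := hf
    rw [h1, h2, h2, map_sub, map_smul, h1, h3, Finsupp.mapDomain_apply w.injective]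

theorem thetaMul_thetaMul (i j : Fin N) (f : Grass k N) :
    thetaMul i (thetaMul j f) = -thetaMul j (thetaMul i f) := by
  simp only [thetaMul, LinearMap.mulLeft_apply, ← mul_assoc]
  rw [← neg_mul]
  congr 1
  exact eq_neg_of_add_eq_zero_left (ExteriorAlgebra.ι_add_mul_swap _ _)

theorem dTheta_dTheta (i j : Fin N) (f : Grass k N) :
    dTheta i (dTheta j f) = -dTheta j (dTheta i f) :=
  CliffordAlgebra.contractLeft_comm _ _ f

theorem dTheta_thetaMul_of_ne {i j : Fin N} (h : i ≠ j) (f : Grass k N) :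
    dTheta i (thetaMul j f) = -thetaMul j (dTheta i f) := by
  refine (CliffordAlgebra.contractLeft_ι_mul _ _ _).trans ?_
  simp [h.symm]
  rfl

/-- `θ_j ∂_{θ_j}`. -/
def thetaNum (j : Fin N) : Module.End k (Grass k N) := thetaMul j * dTheta j

theorem permTheta_mul_thetaNum (w : Equiv.Perm (Fin N)) (j : Fin N) :
    (permTheta w * thetaNum j : Module.End k (Grass k N)) = thetaNum (w j) * permTheta w := by
  rw [thetaNum, thetaNum, ← mul_assoc, permTheta_mul_thetaMul, mul_assoc, permTheta_mul_dTheta,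
    mul_assoc]

theorem commute_thetaNum (i j : Fin N) :
    Commute (thetaNum i : Module.End k (Grass k N)) (thetaNum j) := by
  by_cases h : i = j
  · rw [h]
  refine LinearMap.ext fun f => ?_
  simp only [thetaNum, Module.End.mul_apply]
  rw [dTheta_thetaMul_of_ne h, dTheta_thetaMul_of_ne (Ne.symm h), map_neg, map_neg,
    thetaMul_thetaMul, dTheta_dTheta, map_neg, map_neg, neg_neg]

theorem superPerm_mul (v w : Equiv.Perm (Fin N)) :
    (superPerm (v * w) : Module.End k (SuperPoly k N)) = superPerm v * superPerm w := by
  have e : (permX (v * w) : Module.End k (BosPoly k N)) = permX v * permX w :=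
    map_mul permXHom v w
  rw [superPerm, e, permTheta_mul_permTheta, liftTheta_mul, ← liftXHom_apply, map_mul,
    liftXHom_apply, liftXHom_apply, superPerm, superPerm, mul_assoc, mul_assoc,
    ← mul_assoc (liftTheta (permTheta w)), (commute_liftTheta_liftX _ _).eq, ← mul_assoc (liftX _)]

theorem superPerm_apply_of_mem (w : Equiv.Perm (Fin N)) {f : SuperPoly k N}
    (hf : f ∈ symSuperPoly k N) : superPerm w f = f := by
  induction w using Equiv.Perm.swap_induction_on with
  | one =>
    have h1 : (permX 1 : Module.End k (BosPoly k N)) = 1 := map_one permXHom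
    have h2 : (permTheta 1 : Module.End k (Grass k N)) = 1 := by
      rw [permTheta, Equiv.Perm.coe_one, Finsupp.lmapDomain_id, ExteriorAlgebra.map_id]
      rfl
    rw [superPerm, h1, h2, ← liftXHom_apply, map_one, mul_one, liftTheta]
    simp [Module.End.one_eq_id]
  | swap_mul w x y _ ih => rw [superPerm_mul, Module.End.mul_apply, ih, hf x y]

theorem commute_superPerm_liftX_of_permX {w : Equiv.Perm (Fin N)}
    {T : Module.End k (BosPoly k N)} (h : Commute (permX w) T) :
    Commute (superPerm w) (liftX T) :=
  (commute_liftTheta_liftX _ _).mul_left (h.map liftXHom)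

theorem superPerm_mul_sum (v : Equiv.Perm (Fin N)) (T : Module.End k (SuperPoly k N)) :
    superPerm v * ∑ w : Equiv.Perm (Fin N), superPerm w * T =
      ∑ w : Equiv.Perm (Fin N), superPerm w * T := by
  rw [Finset.mul_sum]
  refine Finset.sum_equiv (Equiv.mulLeft v) (by simp) fun w _ => ?_
  rw [← mul_assoc, ← superPerm_mul, Equiv.coe_mulLeft]

/-! ## Conserved charges -/

section Charges

variable {β c : k} {x D : Fin N → Module.End k (BosPoly k N)}

variable (β c x D) in
/-- `∑_j 𝒟_j ^ n` for the Cherednik operators of `x` and `D`. -/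
def chargeH (n : ℕ) : Module.End k (SuperPoly k N) :=
  ∑ j : Fin N, liftX (cherednik β c x D permXHom j) ^ n

variable (β c x D) in
/-- `∑_{w ∈ S_N} 𝒦_w θ_1 ∂_{θ_1} 𝒟_1 ^ r` for the Cherednik operators of `x` and `D`. -/
def chargeI [NeZero N] (r : ℕ) : Module.End k (SuperPoly k N) :=
  ∑ w : Equiv.Perm (Fin N), superPerm w * liftTheta (thetaMul 0) * liftTheta (dTheta 0) *
    liftX (cherednik β c x D permXHom 0) ^ r

theorem chargeH_eq_liftX (n : ℕ) :
    chargeH β c x D n = liftX (∑ j : Fin N, cherednik β c x D permXHom j ^ n) := by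
  simp only [chargeH, ← liftXHom_apply, map_sum, map_pow]

theorem chargeI_eq [NeZero N] (r : ℕ) : chargeI β c x D r = ∑ w : Equiv.Perm (Fin N),
    superPerm w * (liftTheta (thetaNum 0) * liftX (cherednik β c x D permXHom 0 ^ r)) := by
  simp only [chargeI, thetaNum, liftTheta_mul, ← liftXHom_apply, map_pow, mul_assoc]

variable (c x D) in
/-- `∑_{w ∈ S_N} θ_{w(1)} ∂_{θ_{w(1)}} E_{w(1)} ^ r`, which agrees with `chargeI` on symmetric
superpolynomials. -/
def heckmanI [NeZero N] (r : ℕ) : Module.End k (SuperPoly k N) :=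
  ∑ w : Equiv.Perm (Fin N), liftTheta (thetaNum (w 0)) * liftX (heckman c x D (w 0) ^ r)

theorem commute_superPerm_chargeH (h : DunklRel β x D permXHom) (w : Equiv.Perm (Fin N)) (n : ℕ) :
    Commute (superPerm w) (chargeH β c x D n) := by
  rw [chargeH_eq_liftX]
  exact commute_superPerm_liftX_of_permX (h.commute_K_sum_cherednik_pow w n)

theorem commute_chargeH_liftX_cherednik (h : DunklRel β x D permXHom) (j : Fin N) (m n : ℕ) :
    Commute (chargeH β c x D m) (liftX (cherednik β c x D permXHom j ^ n)) := by
  rw [chargeH_eq_liftX]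
  refine Commute.map (Commute.sum_left _ _ _ fun i _ => ?_) liftXHom
  exact Commute.pow_pow (h.cherednik_mul_cherednik i j) m n

theorem commute_chargeH_chargeH (h : DunklRel β x D permXHom) (m n : ℕ) :
    Commute (chargeH β c x D m) (chargeH β c x D n) := by
  rw [chargeH_eq_liftX n, ← liftXHom_apply, map_sum]
  exact Commute.sum_right _ _ _ fun j _ => commute_chargeH_liftX_cherednik h j m n

theorem commute_chargeH_chargeI [NeZero N] (h : DunklRel β x D permXHom) (m n : ℕ) :
    Commute (chargeH β c x D m) (chargeI β c x D n) := by
  rw [chargeI_eq]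
  refine Commute.sum_right _ _ _ fun w _ => ?_
  refine (commute_superPerm_chargeH h w m).symm.mul_right (Commute.mul_right ?_ ?_)
  · rw [chargeH_eq_liftX]
    exact (commute_liftTheta_liftX _ _).symm
  · exact commute_chargeH_liftX_cherednik h 0 m n

/-- Unlike the Cherednik operators, the Heckman operators are genuinely permuted by `S_N`, so `𝒦_w`
passes to the right at the cost of relabelling `j`. -/
theorem superPerm_mul_heckman (h : DunklRel β x D permXHom) (w : Equiv.Perm (Fin N)) (j : Fin N)
    (n : ℕ) : superPerm w * (liftTheta (thetaNum j) * liftX (heckman c x D j ^ n)) =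
      liftTheta (thetaNum (w j)) * liftX (heckman c x D (w j) ^ n) * superPerm w := by
  have e : permX w * heckman c x D j ^ n = heckman c x D (w j) ^ n * permX w :=
    SemiconjBy.pow_right (h.K_mul_heckman w j) n
  rw [superPerm, mul_assoc, ← mul_assoc (liftX (permX w)),
    ← (commute_liftTheta_liftX (thetaNum j) (permX w)).eq, mul_assoc, ← liftXHom_apply,
    ← liftXHom_apply, ← map_mul, e, map_mul, ← mul_assoc, ← liftTheta_mul, permTheta_mul_thetaNum,
    liftTheta_mul, mul_assoc, ← mul_assoc (liftTheta (permTheta w)), liftXHom_apply,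
    (commute_liftTheta_liftX _ _).eq]
  simp only [mul_assoc]

theorem cherednik_zero [NeZero N] (h : DunklRel β x D permXHom) :
    cherednik β c x D permXHom 0 = heckman c x D 0 := by
  have h0 : (Finset.univ.filter fun l : Fin N => l < 0) = ∅ :=
    Finset.filter_false_of_mem fun l _ => (Fin.zero_le l).not_gt
  rw [h.cherednik_eq, jucysMurphy, h0]
  simp

/-- The first Cherednik operator has an empty Jucys-Murphy sum, so it is a Heckman operator; once
`𝒦_w` stands on the right it fixes `f`. -/
theorem chargeI_apply_of_mem [NeZero N] (h : DunklRel β x D permXHom) (n : ℕ) {f : SuperPoly k N}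
    (hf : f ∈ symSuperPoly k N) : chargeI β c x D n f = heckmanI c x D n f := by
  rw [chargeI_eq, heckmanI, LinearMap.sum_apply, LinearMap.sum_apply]
  refine Finset.sum_congr rfl fun w _ => ?_
  rw [cherednik_zero h, superPerm_mul_heckman h, Module.End.mul_apply,
    superPerm_apply_of_mem w hf]

theorem chargeH_mem (h : DunklRel β x D permXHom) (n : ℕ) {f : SuperPoly k N}
    (hf : f ∈ symSuperPoly k N) : chargeH β c x D n f ∈ symSuperPoly k N := by
  intro i j
  rw [← Module.End.mul_apply, (commute_superPerm_chargeH h _ n).eq, Module.End.mul_apply, hf i j]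

theorem chargeI_mem [NeZero N] (n : ℕ) (f : SuperPoly k N) :
    chargeI β c x D n f ∈ symSuperPoly k N := by
  intro i j
  rw [← Module.End.mul_apply, chargeI_eq, superPerm_mul_sum]

theorem commute_heckmanI [CharZero k] [NeZero N] (h : DunklRel β x D permXHom) (m n : ℕ) :
    Commute (heckmanI c x D m) (heckmanI c x D n) := by
  let F : ℕ → Fin N → Module.End k (SuperPoly k N) := fun n j =>
    liftTheta (thetaNum j) * liftX (heckman c x D j ^ n)
  have hF : ∀ (m n : ℕ) (i j : Fin N), F m i * F n j =
      liftTheta (thetaNum i * thetaNum j) *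
        liftXHom (heckman c x D i ^ m * heckman c x D j ^ n) := by
    intro m n i j
    simp only [F]
    rw [mul_assoc, ← mul_assoc (liftX _), ← (commute_liftTheta_liftX _ _).eq, liftTheta_mul,
      map_mul, mul_assoc, mul_assoc]
    rfl
  have hskew : ∀ i j : Fin N,
      (F m i * F n j - F n j * F m i) + (F m j * F n i - F n i * F m j) = 0 := by
    intro i j
    simp only [hF, (commute_thetaNum j i).eq]
    rw [← mul_sub, ← mul_sub, ← mul_add, ← map_sub, ← map_sub, ← map_add, h.lie_heckman_pow,
      map_zero, mul_zero]
  -- `hskew` says that the summand is antisymmetric under exchange of `w` and `v`. Thus `S = -S`,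
  -- and characteristic `0` gives `S = 0`.
  set S := ∑ w : Equiv.Perm (Fin N), ∑ v : Equiv.Perm (Fin N),
    (F m (w 0) * F n (v 0) - F n (v 0) * F m (w 0)) with hS
  have h2 : S + S = 0 := by
    conv_lhs => arg 2; rw [hS, Finset.sum_comm]
    rw [hS, ← Finset.sum_add_distrib]
    refine Finset.sum_eq_zero fun w _ => ?_
    rw [← Finset.sum_add_distrib]
    exact Finset.sum_eq_zero fun v _ => hskew _ _
  have h0 : S = 0 := by
    rw [← two_smul k] at h2
    exact (smul_eq_zero.1 h2).resolve_left two_ne_zero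
  have e : heckmanI c x D m * heckmanI c x D n - heckmanI c x D n * heckmanI c x D m = S := by
    change (∑ w : Equiv.Perm (Fin N), F m (w 0)) * (∑ v : Equiv.Perm (Fin N), F n (v 0)) -
      (∑ v : Equiv.Perm (Fin N), F n (v 0)) * (∑ w : Equiv.Perm (Fin N), F m (w 0)) = S
    rw [Finset.sum_mul_sum, Finset.sum_mul_sum, Finset.sum_comm (γ := Equiv.Perm (Fin N))
      (f := fun v w : Equiv.Perm (Fin N) => F n (v 0) * F m (w 0))]
    simp only [hS, Finset.sum_sub_distrib]
  rw [h0] at e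
  exact sub_eq_zero.1 e

theorem chargeI_chargeI_apply [CharZero k] [NeZero N] (h : DunklRel β x D permXHom) (m n : ℕ)
    {f : SuperPoly k N} (hf : f ∈ symSuperPoly k N) :
    chargeI β c x D m (chargeI β c x D n f) = chargeI β c x D n (chargeI β c x D m f) := by
  rw [chargeI_apply_of_mem h m (chargeI_mem n f), chargeI_apply_of_mem h n (chargeI_mem m f),
    chargeI_apply_of_mem h m hf, chargeI_apply_of_mem h n hf]
  exact LinearMap.congr_fun (commute_heckmanI h m n) f

end Charges

/-! ## Exponentials of locally nilpotent operators -/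

section LocExp

variable {V : Type*} [AddCommGroup V] [Module k V]

theorem pow_apply_eq_zero_of_le (T : Module.End k V) {v : V} {r s : ℕ} (hrs : r ≤ s)
    (h : (T ^ r) v = 0) : (T ^ s) v = 0 := by
  rw [← Nat.sub_add_cancel hrs, pow_add, Module.End.mul_apply, h, map_zero]

theorem locExp_apply (T : Module.End k V) (hT : ∀ v, ∃ r : ℕ, (T ^ r) v = 0) {v : V} {s : ℕ}
    (hs : (T ^ s) v = 0) :
    locExp T hT v = ∑ r ∈ Finset.range s, ((r.factorial : k)⁻¹) • (T ^ r) v := by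
  refine finsum_eq_sum_of_support_subset _ fun r hr => ?_
  by_contra h
  refine hr ?_
  have : s ≤ r := by simpa using h
  simp [pow_apply_eq_zero_of_le T this hs]

/-- If `B = [T, a]` commutes with `T`, then `a e^T = e^T (a - B)`. -/
theorem mul_locExp [CharZero k] (T : Module.End k V) (hT : ∀ v, ∃ r : ℕ, (T ^ r) v = 0)
    {a B : Module.End k V} (hB : T * a = a * T + B) (hTB : Commute T B) :
    a * locExp T hT = locExp T hT * (a - B) := by
  have hpow : ∀ r : ℕ, a * T ^ (r + 1) = T ^ (r + 1) * a - (r + 1) • (T ^ r * B) := by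
    intro r
    induction r with
    | zero => simp [hB]
    | succ r ih =>
      have e : a * T = T * a - B := by rw [hB]; abel
      rw [pow_succ' T (r + 1), ← mul_assoc, e, sub_mul, mul_assoc, ih,
        ← (hTB.pow_left (r + 1)).eq, mul_sub, mul_smul_comm, ← mul_assoc T (T ^ r), ← pow_succ',
        ← mul_assoc, add_smul (r + 1) 1, one_smul]
      abel
  refine LinearMap.ext fun v => ?_
  obtain ⟨s1, h1⟩ := hT v
  obtain ⟨s2, h2⟩ := hT (a v)
  obtain ⟨s3, h3⟩ := hT (B v)
  set s := max s1 (max s2 s3)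
  -- The series at `v` and `a v` are cut one term later than at `B v`, since `hpow` pairs `T^(r+1)`
  -- with `T^r B`; the factor `r + 1` turns `1/(r+1)!` into `1/r!`.
  have h1' : (T ^ (s + 1)) v = 0 := pow_apply_eq_zero_of_le T (by omega) h1
  have h2' : (T ^ (s + 1)) (a v) = 0 := pow_apply_eq_zero_of_le T (by omega) h2
  have h3' : (T ^ s) (B v) = 0 := pow_apply_eq_zero_of_le T (by omega) h3
  rw [Module.End.mul_apply, Module.End.mul_apply, LinearMap.sub_apply, map_sub,
    locExp_apply T hT h1', locExp_apply T hT h2', locExp_apply T hT h3', map_sum,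
    Finset.sum_range_succ', Finset.sum_range_succ', add_sub_right_comm,
    ← Finset.sum_sub_distrib]
  congr 1
  · refine Finset.sum_congr rfl fun r _ => ?_
    have hr := LinearMap.congr_fun (hpow r) v
    simp only [Module.End.mul_apply, LinearMap.sub_apply, LinearMap.smul_apply] at hr
    have hf : (((r + 1).factorial : ℕ) : k)⁻¹ * ((r + 1 : ℕ) : k) = ((r.factorial : ℕ) : k)⁻¹ := by
      have h0 : ((r + 1 : ℕ) : k) ≠ 0 := Nat.cast_ne_zero.2 r.succ_ne_zero
      rw [Nat.factorial_succ, Nat.cast_mul]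
      field_simp
    rw [map_smul, hr, smul_sub, ← Nat.cast_smul_eq_nsmul k (r + 1), smul_smul, hf]
  · simp

theorem commute_locExp [CharZero k] (T : Module.End k V) (hT : ∀ v, ∃ r : ℕ, (T ^ r) v = 0)
    {a : Module.End k V} (h : Commute T a) : Commute a (locExp T hT) := by
  have := mul_locExp T hT (a := a) (B := 0) (by rw [add_zero]; exact h) (Commute.zero_right T)
  rwa [sub_zero] at this

theorem locExp_eq_aeval_trunc [CharZero k] (T : Module.End k V)
    (hT : ∀ v, ∃ r : ℕ, (T ^ r) v = 0) {v : V} {s : ℕ} (hs : (T ^ s) v = 0) :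
    locExp T hT v = Polynomial.aeval T (PowerSeries.trunc s (PowerSeries.exp k)) v := by
  rw [locExp_apply T hT hs, PowerSeries.trunc_apply, map_sum, LinearMap.sum_apply,
    Finset.range_eq_Ico]
  refine Finset.sum_congr rfl fun r _ => ?_
  rw [Polynomial.aeval_monomial, PowerSeries.coeff_exp]
  simp [Algebra.algebraMap_eq_smul_one]

/-- On a vector killed by `T^s` both exponentials are polynomials in `T`, the truncations of
`exp(X)` and `exp(-X)`, and their product is `1` modulo `X^s`. -/
theorem locExp_neg_mul_locExp [CharZero k] (T S : Module.End k V) (hST : S = -T)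
    (hT : ∀ v, ∃ r : ℕ, (T ^ r) v = 0) (hS : ∀ v, ∃ r : ℕ, (S ^ r) v = 0) :
    locExp S hS * locExp T hT = 1 := by
  refine LinearMap.ext fun v => ?_
  obtain ⟨s, hs⟩ := hT v
  set p := PowerSeries.trunc s (PowerSeries.exp k)
  set q := PowerSeries.trunc s (PowerSeries.rescale (-1 : k) (PowerSeries.exp k))
  have hq : Polynomial.aeval S p = Polynomial.aeval T q := by
    simp only [p, q, PowerSeries.trunc_apply, map_sum, Polynomial.aeval_monomial,
      PowerSeries.coeff_rescale, hST]
    refine Finset.sum_congr rfl fun r _ => ?_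
    rw [neg_pow, map_mul, map_pow, map_neg, map_one, ← mul_assoc, Algebra.commutes, mul_assoc]
  -- The same truncation order `s` works for the second exponential, because polynomials in `T`
  -- preserve the kernel of `T^s`.
  have hTs : (T ^ s) (Polynomial.aeval T p v) = 0 := by
    rw [← Module.End.mul_apply, ← Polynomial.aeval_X_pow (R := k) T, ← map_mul, mul_comm, map_mul,
      Module.End.mul_apply, Polynomial.aeval_X_pow, hs, map_zero]
  have hSs : (S ^ s) (Polynomial.aeval T p v) = 0 := by
    rw [hST, neg_pow, Module.End.mul_apply, hTs, map_zero]
  have hdvd : (Polynomial.X : Polynomial k) ^ s ∣ q * p - 1 := by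
    rw [Polynomial.X_pow_dvd_iff]
    intro d hd
    rw [Polynomial.coeff_sub, ← Polynomial.coeff_coe, Polynomial.coe_mul,
      ← PowerSeries.coeff_mul_eq_coeff_trunc_mul_trunc _ _ hd, mul_comm]
    erw [PowerSeries.exp_mul_exp_neg_eq_one, PowerSeries.coeff_one, Polynomial.coeff_one, sub_self]
  obtain ⟨g, hg⟩ := hdvd
  rw [Module.End.mul_apply, locExp_eq_aeval_trunc T hT hs, locExp_eq_aeval_trunc S hS hSs, hq,
    ← Module.End.mul_apply, ← map_mul, sub_eq_iff_eq_add.1 hg, mul_comm, map_add, map_mul]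
  simp [hs]

end LocExp

/-! ## The operators `𝒟_j`, `𝒟_j^ω` and the similarity transformation -/

/-- For `l > j`, `x_l / x_{jl} = x_j / x_{jl} - 1` turns each term into the form `x_j D_j` requires.
The `N - 1 - j` resulting constants (indices from `0`) join `-β j` to give `-β (N - 1)`, independent
of `j`. -/
theorem dunklTrig_eq (β : k) (j : Fin N) :
    dunklTrig β j = cherednik β (β * ((N : k) - 1)) xMul (dunkl β) permXHom j := by
  have h1 : ∀ l ∈ Finset.univ.filter (fun l => j < l), (xMul l * divDiff j l :
      Module.End k (BosPoly k N)) = xMul j * divDiff j l - 1 + permX (Equiv.swap j l) := by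
    intro l hl
    have hjl : j ≠ l := by
      have : j < l := by simpa using hl
      exact this.ne
    refine LinearMap.ext fun f => ?_
    simp only [Module.End.mul_apply, LinearMap.add_apply, LinearMap.sub_apply, xMul,
      LinearMap.mulLeft_apply, Module.End.one_apply]
    linear_combination -X_sub_X_mul_divDiff hjl f
  have hcard : ((Finset.univ.filter (fun l : Fin N => j < l)).card : k) = (N : k) - 1 - (j : ℕ) := by
    rw [Finset.filter_lt_eq_Ioi, Fin.card_Ioi, Nat.sub_sub, Nat.cast_sub (by omega)]
    push_cast
    ring
  rw [dunklTrig, cherednik, dunkl, Finset.sum_congr rfl h1, Finset.sum_add_distrib,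
    Finset.sum_sub_distrib, Finset.sum_const, ← Nat.cast_smul_eq_nsmul k, hcard, mul_add,
    mul_smul_comm, Finset.mul_sum, sum_univ_erase]
  simp only [permXHom_apply]
  module

theorem dunklOmega_eq (β : k) {ω : k} (hω : (2 * ω) ≠ 0) (j : Fin N) :
    dunklOmega β ω j = cherednik β (β * ((N : k) - 1))
      (fun j => xMul j - (2 * ω)⁻¹ • dunkl β j) (dunkl β) permXHom j := by
  rw [dunklOmega, cherednik, dunklAdj, ← smul_mul_assoc, smul_sub, smul_smul, inv_mul_cancel₀ hω,
    one_smul]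
  rfl

theorem liftX_dunklRel (β : k) : DunklRel β (fun j : Fin N => liftX (xMul j))
    (fun j => liftX (dunkl β j)) (((liftXHom : Module.End k (BosPoly k N) →ₐ[k]
      Module.End k (SuperPoly k N)) : Module.End k (BosPoly k N) →*
        Module.End k (SuperPoly k N)).comp permXHom) :=
  (dunklRel β).map liftXHom

theorem commute_delta_liftTheta (β : k) (S : Module.End k (Grass k N)) :
    Commute (delta β) (liftTheta S) := by
  rw [delta_eq_liftX]
  exact (commute_liftTheta_liftX _ _).symm

section Similarity

variable [CharZero k]

theorem expDelta_neg_mul (β c : k) :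
    (expDelta β (-c) * expDelta β c : Module.End k (SuperPoly k N)) = 1 :=
  locExp_neg_mul_locExp _ _ (neg_smul c (delta β)) _ _

theorem commute_expDelta {β c : k} {a : Module.End k (SuperPoly k N)} (h : Commute (delta β) a) :
    Commute a (expDelta β c) :=
  commute_locExp _ _ (h.smul_left c)

theorem liftX_dunklTrig_mul_expDelta (β : k) {ω : k} (hω : ω ≠ 0) (j : Fin N) :
    liftX (dunklTrig β j) * expDelta β (4 * ω)⁻¹ =
      expDelta β (4 * ω)⁻¹ * liftX (dunklOmega β ω j) := by
  have h := liftX_dunklRel (N := N) β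
  set c := (4 * ω)⁻¹ with hc
  -- Since `[cΔ, x_j] = 2c D_j`, this equality matches the exponent `1/(4ω)` with the shift
  -- `1/(2ω)`.
  have hc2 : (2 * ω)⁻¹ = c * 2 := by rw [hc]; field_simp; norm_num
  have hD : ∀ j : Fin N, Commute (delta β) (liftX (dunkl β j)) := h.commute_sum_D_sq_D
  have hK : ∀ w : Equiv.Perm (Fin N), Commute (delta β) (liftX (permX w)) := h.commute_sum_D_sq_K
  have hx : liftX (xMul j) * expDelta β c = expDelta β c *
      (liftX (xMul j) - (2 * ω)⁻¹ • liftX (dunkl β j)) := by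
    refine mul_locExp _ _ ?_ (((hD j).smul_left c).smul_right _)
    have h1 : delta β * liftX (xMul j) = liftX (xMul j) * delta β + (2 : k) • liftX (dunkl β j) :=
      h.sum_D_sq_mul_x j
    rw [smul_mul_assoc, h1, smul_add, mul_smul_comm, smul_smul, hc2]
  have hK' : Commute (∑ l ∈ Finset.univ.filter (fun l => j < l), liftXHom (permX (Equiv.swap j l)))
      (expDelta β c) := Commute.sum_left _ _ _ fun l _ => commute_expDelta (hK _)
  rw [dunklTrig_eq, dunklOmega_eq β (mul_ne_zero two_ne_zero hω), ← liftXHom_apply,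
    ← liftXHom_apply, cherednik, cherednik]
  simp only [map_sub, map_add, map_mul, map_smul, map_sum, map_one, permXHom_apply]
  simp only [sub_mul _ _ (expDelta β c), add_mul _ _ (expDelta β c), mul_sub (expDelta β c),
    mul_add (expDelta β c), smul_mul_assoc, mul_smul_comm, one_mul, mul_one, hK'.eq]
  rw [← mul_assoc (expDelta β c), liftXHom_apply, liftXHom_apply, ← hx, mul_assoc, mul_assoc,
    (commute_expDelta (hD j)).eq]

theorem liftX_dunklTrig_pow_mul_expDelta (β : k) {ω : k} (hω : ω ≠ 0) (j : Fin N) (n : ℕ) :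
    liftX (dunklTrig β j) ^ n * expDelta β (4 * ω)⁻¹ =
      expDelta β (4 * ω)⁻¹ * liftX (dunklOmega β ω j) ^ n :=
  (SemiconjBy.pow_right (liftX_dunklTrig_mul_expDelta β hω j).symm n).symm

theorem ratH_eq (β : k) {ω : k} (hω : ω ≠ 0) (n : ℕ) :
    (ratH β ω n : Module.End k (SuperPoly k N)) =
      expDelta β (-(4 * ω)⁻¹) * trigH β n * expDelta β (4 * ω)⁻¹ := by
  have h : trigH β n * expDelta β (4 * ω)⁻¹ =
      expDelta β (4 * ω)⁻¹ * (ratH β ω n : Module.End k (SuperPoly k N)) := by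
    rw [trigH, ratH, Finset.sum_mul, Finset.mul_sum]
    exact Finset.sum_congr rfl fun j _ => liftX_dunklTrig_pow_mul_expDelta β hω j n
  rw [mul_assoc, h, ← mul_assoc, expDelta_neg_mul, one_mul]

theorem ratI_eq [NeZero N] (β : k) {ω : k} (hω : ω ≠ 0) (n : ℕ) :
    (ratI β ω n : Module.End k (SuperPoly k N)) =
      expDelta β (-(4 * ω)⁻¹) * trigI β n * expDelta β (4 * ω)⁻¹ := by
  have h : trigI β n * expDelta β (4 * ω)⁻¹ =
      expDelta β (4 * ω)⁻¹ * (ratI β ω n : Module.End k (SuperPoly k N)) := by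
    rw [trigI, ratI, Finset.sum_mul, Finset.mul_sum]
    refine Finset.sum_congr rfl fun w _ => ?_
    have hw : Commute (delta β) (superPerm w * liftTheta (thetaMul 0) * liftTheta (dTheta 0) :
        Module.End k (SuperPoly k N)) := by
      refine Commute.mul_right (Commute.mul_right ?_ (commute_delta_liftTheta β _))
        (commute_delta_liftTheta β _)
      exact (commute_delta_liftTheta β _).mul_right ((liftX_dunklRel β).commute_sum_D_sq_K w)
    rw [mul_assoc, liftX_dunklTrig_pow_mul_expDelta β hω, ← mul_assoc, ← mul_assoc,
      (commute_expDelta hw).eq]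
  rw [mul_assoc, h, ← mul_assoc, expDelta_neg_mul, one_mul]

end Similarity

theorem ratH_eq_chargeH (β : k) {ω : k} (hω : (2 * ω) ≠ 0) (n : ℕ) :
    (ratH β ω n : Module.End k (SuperPoly k N)) = chargeH β (β * ((N : k) - 1))
      (fun j => xMul j - (2 * ω)⁻¹ • dunkl β j) (dunkl β) n := by
  simp only [ratH, chargeH, dunklOmega_eq β hω]

theorem ratI_eq_chargeI [NeZero N] (β : k) {ω : k} (hω : (2 * ω) ≠ 0) (n : ℕ) :
    (ratI β ω n : Module.End k (SuperPoly k N)) = chargeI β (β * ((N : k) - 1))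
      (fun j => xMul j - (2 * ω)⁻¹ • dunkl β j) (dunkl β) n := by
  simp only [ratI, chargeI, dunklOmega_eq β hω]

theorem lie_restrictSym_eq_zero {S T : Module.End k (SuperPoly k N)}
    (hS : ∀ f ∈ symSuperPoly k N, S f ∈ symSuperPoly k N)
    (hT : ∀ f ∈ symSuperPoly k N, T f ∈ symSuperPoly k N)
    (h : ∀ f ∈ symSuperPoly k N, S (T f) = T (S f)) :
    ⁅restrictSym S hS, restrictSym T hT⁆ = 0 := by
  rw [Ring.lie_def, sub_eq_zero]
  exact LinearMap.ext fun f => Subtype.ext (h f f.2)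

end

end SrCMS

theorem mainTheorem4 (k : Type*) [Field k] [CharZero k] (N : ℕ) [NeZero N]
    (β ω : k) (hω : ω ≠ 0) :
    (∀ n ∈ Finset.Icc 1 N,
      (SrCMS.ratH β ω n : Module.End k (SrCMS.SuperPoly k N)) =
          SrCMS.expDelta β (-(4 * ω)⁻¹) * SrCMS.trigH β n * SrCMS.expDelta β (4 * ω)⁻¹ ∧
      (SrCMS.ratI β ω (n - 1) : Module.End k (SrCMS.SuperPoly k N)) =
          SrCMS.expDelta β (-(4 * ω)⁻¹) * SrCMS.trigI β (n - 1) * SrCMS.expDelta β (4 * ω)⁻¹) ∧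
    ∃ (hH : ∀ n ∈ Finset.Icc 1 N, ∀ f ∈ SrCMS.symSuperPoly k N,
          SrCMS.ratH β ω n f ∈ SrCMS.symSuperPoly k N)
      (hI : ∀ n ∈ Finset.Icc 1 N, ∀ f ∈ SrCMS.symSuperPoly k N,
          SrCMS.ratI β ω (n - 1) f ∈ SrCMS.symSuperPoly k N),
      ∀ (m : ℕ) (hm : m ∈ Finset.Icc 1 N) (n : ℕ) (hn : n ∈ Finset.Icc 1 N),
        ⁅SrCMS.restrictSym (SrCMS.ratH β ω m) (hH m hm),
          SrCMS.restrictSym (SrCMS.ratH β ω n) (hH n hn)⁆ = 0 ∧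
        ⁅SrCMS.restrictSym (SrCMS.ratH β ω m) (hH m hm),
          SrCMS.restrictSym (SrCMS.ratI β ω (n - 1)) (hI n hn)⁆ = 0 ∧
        ⁅SrCMS.restrictSym (SrCMS.ratI β ω (m - 1)) (hI m hm),
          SrCMS.restrictSym (SrCMS.ratI β ω (n - 1)) (hI n hn)⁆ = 0 := by
  have h2 : 2 * ω ≠ 0 := mul_ne_zero two_ne_zero hω
  -- The relations for `x_j - D_j/(2ω)` make the general results on `chargeH` and `chargeI` apply to
  -- the rational charges.
  have hrel := (SrCMS.dunklRel (N := N) β).sub_smul (2 * ω)⁻¹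
  refine ⟨fun n _ => ⟨SrCMS.ratH_eq β hω n, SrCMS.ratI_eq β hω (n - 1)⟩, ?_, ?_, ?_⟩
  · intro n _ f hf
    rw [SrCMS.ratH_eq_chargeH β h2]
    exact SrCMS.chargeH_mem hrel n hf
  · intro n _ f _
    rw [SrCMS.ratI_eq_chargeI β h2]
    exact SrCMS.chargeI_mem (n - 1) f
  · intro m _ n _
    refine ⟨SrCMS.lie_restrictSym_eq_zero _ _ fun f hf => ?_,
      SrCMS.lie_restrictSym_eq_zero _ _ fun f hf => ?_,
      SrCMS.lie_restrictSym_eq_zero _ _ fun f hf => ?_⟩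
    · rw [SrCMS.ratH_eq_chargeH β h2, SrCMS.ratH_eq_chargeH β h2]
      exact LinearMap.congr_fun (SrCMS.commute_chargeH_chargeH hrel m n) f
    · rw [SrCMS.ratH_eq_chargeH β h2, SrCMS.ratI_eq_chargeI β h2]
      exact LinearMap.congr_fun (SrCMS.commute_chargeH_chargeI hrel m (n - 1)) f
    · rw [SrCMS.ratI_eq_chargeI β h2, SrCMS.ratI_eq_chargeI β h2]
      exact SrCMS.chargeI_chargeI_apply hrel (m - 1) (n - 1) hf
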